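/- Let $P\subset\mathbb R^d$ be a closed convex cone with $P-P=\mathbb R^d$ and $P\cap(-P)=\{0\}$; write $b\le a$ if $a-b\in P$. Let $(Y,\mathcal B)$ be a countably generated measurable space with a measurable action of $\mathbb R^d$, written $(y,a)\mapsto y+a$, let $\lambda$ be an $\mathbb R^d$-invariant $\sigma$-finite measure on $Y$, and let $X\in\mathcal B$ satisfy $X+a\subset X$ for all $a\in P$ and $\bigcap_{a\in P}(X+a)=\emptyset$. Let $\eta$ be a Poisson process on $Y$ with intensity measure $\lambda$, realised on a complete probability space $(\Omega,\mathcal F,\mathbb P)$. For $a,b$ in $P$ with $a\le b$ let $\mathcal F_{a,b}$ be the complete $\sigma$-algebra generated by the variables $\eta(B)$, $B\in\mathcal B$, $B\subset (X+a)\setminus(X+b)$, and let $\mathcal F_a=\mathcal F_{0,a}$. For $c\in P$ let $S_c:L^2(\Omega,\mathcal F_{a,b},\mathbb P)\to L^2(\Omega,\mathcal F_{a+c,b+c},\mathbb P)$ be the unitary with $S_c\big(\varphi(\eta(B_1),\dots,\eta(B_n))\big)=\varphi(\eta(B_1+c),\dots,\eta(B_n+c))$. The Poisson product system $E$ over $P$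 has the fibres $E(a)=L^2(\Omega,\mathcal F_a,\mathbb P)$ (complex valued), $a\in P$, and the product $E(a)\times E(b)\to E(a+b)$, $(f,g)\mapsto f\,S_a(g)$. A vector $u\in E(a)$ is called decomposable if $u\neq0$ and for every $b\in P$ with $b\le a$ there are $v\in E(b)$ and $w\in E(a-b)$ with $u=v\,S_b(w)$. Fix a measurable map $\ell:\mathbb C\setminus\{0\}\to\mathbb C$ with $e^{\ell(z)}=z$ for all $z\ne 0$ and $\ell(x)=\log x$ for $x>0$. For a square integrable complex valued simple function $f$ on $X$ that does not take the value $-1$, put $u_f=\ell(1+f)$, $\eta(u_f)=\int u_f\,d\eta$ and $\Sigma_f=e^{\eta(u_f)}/\mathbb E(e^{\eta(u_f)})$. The map $f\mapsto\Sigma_f$ extends uniquely to a continuous map $L^2(X,\lambda)\to L^2(\Omega,\mathcal F,\mathbb P)$, again denoted by $f\mapsto\Sigma_f$. For $a\in P$ regard $L^2(X\setminus(X+a))$ as the space of those $f\in L^2(X,\lambda)$ which vanish almost everywhere outside $X\setminus(X+a)$. Then for every $a\in P$ the set $D(a)$ of decomposable vectors of $E(a)$ is \[ D(a)=\{\,c\,\Sigma_f:\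 c\in\mathbb C\setminus\{0\},\ f\in L^2(X\setminus(X+a))\,\}. \] -/

import Mathlib

open MeasureTheory ProbabilityTheory Filter Topology Set
open scoped ENNReal NNReal Pointwise

namespace PoissonProductSystem

section PoissonProcess

variable {Y Ω : Type*} [MeasurableSpace Y] [MeasurableSpace Ω]

/-- `η` is a Poisson process on `Y` with intensity measure `lam`, realised on the probability
space `(Ω, prob)`: a random `σ`-finite measure with values in `ℕ ∪ {∞}` such that `η(B)` is
Poisson distributed with parameter `lam B` (a Poisson variable with parameter `∞` is almost surely
equal to `∞`), and which is completely independent. -/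
structure IsPoissonProcess (η : Ω → Measure Y) (lam : Measure Y) (prob : Measure Ω) : Prop where
  measurable : Measurable η
  sigmaFinite : ∀ ω, SigmaFinite (η ω)
  integerValued : ∀ ω, ∀ B, MeasurableSet B → η ω B = ∞ ∨ ∃ k : ℕ, η ω B = k
  law : ∀ B, MeasurableSet B → lam B ≠ ∞ →
    prob.map (fun ω => η ω B) = (poissonMeasure (lam B).toNNReal).map (fun k : ℕ => (k : ℝ≥0∞))
  law_top : ∀ B, MeasurableSet B → lam B = ∞ → ∀ᵐ ω ∂prob, η ω B = ∞
  indep : ∀ (n : ℕ) (B : Fin n → Set Y), (∀ i, MeasurableSet (B i)) →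
    Pairwise (Function.onFun Disjoint B) → iIndepFun (fun i ω => η ω (B i)) prob

variable {η : Ω → Measure Y} {lam : Measure Y} {prob : Measure Ω}

lemma IsPoissonProcess.measurable_apply (h : IsPoissonProcess η lam prob) {B : Set Y}
    (hB : MeasurableSet B) : Measurable (fun ω => η ω B) :=
  (Measure.measurable_coe hB).comp h.measurable

lemma IsPoissonProcess.indep_fintype (h : IsPoissonProcess η lam prob) {ι : Type*} [Fintype ι]
    (B : ι → Set Y) (hB : ∀ i, MeasurableSet (B i)) (hd : Pairwise (Function.onFun Disjoint B)) :
    iIndepFun (fun i ω => η ω (B i)) prob := by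
  classical
  let e := Fintype.equivFin ι
  have := h.indep (Fintype.card ι) (fun k => B (e.symm k)) (fun k => hB _)
    (fun k l hkl => hd (e.symm.injective.ne hkl))
  simpa using this.precomp (g := e) e.injective

/-- The law of a Poisson process is determined by its intensity measure. -/
lemma IsPoissonProcess.map_eq [IsProbabilityMeasure prob] {η' : Ω → Measure Y}
    (h : IsPoissonProcess η lam prob) (h' : IsPoissonProcess η' lam prob) :
    prob.map η = prob.map η' := by
  classical
  let ev : Measure Y → ({B : Set Y // MeasurableSet B} → ℝ≥0∞) := fun m B => m B
  have hev : Measurable ev := measurable_pi_lambda _ fun B => Measure.measurable_coe B.2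
  have hle : (Measure.instMeasurableSpace : MeasurableSpace (Measure Y))
      ≤ MeasurableSpace.comap ev inferInstance := by
    refine iSup_le fun s => iSup_le fun hs => ?_
    rintro _ ⟨t, ht, rfl⟩
    refine ⟨(fun x => x ⟨s, hs⟩) ⁻¹' t, ?_, rfl⟩
    have ht' : MeasurableSet t := by rwa [BorelSpace.measurable_eq (α := ℝ≥0∞)]
    exact measurable_pi_apply (⟨s, hs⟩ : {B : Set Y // MeasurableSet B}) ht'
  have marg : ∀ B, MeasurableSet B →
      prob.map (fun ω => η ω B) = prob.map (fun ω => η' ω B) := by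
    intro B hB
    by_cases ht : lam B = ∞
    · refine Measure.map_congr ?_
      filter_upwards [h.law_top B hB ht, h'.law_top B hB ht] with ω h1 h2
      rw [h1, h2]
    · rw [h.law B hB ht, h'.law B hB ht]
  have key : prob.map (fun ω => ev (η ω)) = prob.map (fun ω => ev (η' ω)) := by
    refine (map_eq_iff_forall_finset_map_restrict_eq (X := fun t ω => ev (η ω) t)
      (Y := fun t ω => ev (η' ω) t) (hev.comp h.measurable).aemeasurable
      (hev.comp h'.measurable).aemeasurable).2 fun I => ?_
    let A : Finset I → Set Y := fun J => {y | ∀ i : I, y ∈ i.1.1 ↔ i ∈ J}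
    have hA : ∀ J, MeasurableSet (A J) := by
      intro J
      have : A J = ⋂ i : I, {y | y ∈ i.1.1 ↔ i ∈ J} := by ext; simp [A]
      rw [this]
      refine MeasurableSet.iInter fun i => ?_
      by_cases hi : i ∈ J
      · simpa only [hi, iff_true, Set.ofPred_mem_eq] using i.1.2
      · simp only [hi, iff_false]; exact i.1.2.compl
    have hdis : Pairwise (Function.onFun Disjoint A) := by
      intro J K hJK
      rw [Function.onFun, Set.disjoint_left]
      intro y hy hy'
      exact hJK (Finset.ext fun i => (hy i).symm.trans (hy' i))
    have hsum : ∀ (m : Measure Y) (i : I),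
        m i.1.1 = ∑ J ∈ (Finset.univ : Finset (Finset I)).filter (i ∈ ·), m (A J) := by
      intro m i
      rw [← measure_biUnion_finset (fun J _ K _ hJK => hdis hJK) (fun J _ => hA J)]
      congr 1
      ext y
      simp only [Finset.mem_filter, Finset.mem_univ, true_and, mem_iUnion, exists_prop]
      constructor
      · intro hy
        refine ⟨Finset.univ.filter (fun j : I => y ∈ j.1.1), by simpa using hy, ?_⟩
        intro j
        simp
      · rintro ⟨J, hiJ, hy⟩
        exact (hy i).2 hiJ
    let Φ : (Finset I → ℝ≥0∞) → (I → ℝ≥0∞) := fun x i =>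
      ∑ J ∈ (Finset.univ : Finset (Finset I)).filter (i ∈ ·), x J
    have hΦ : Measurable Φ := by
      refine measurable_pi_lambda _ fun i => ?_
      exact Finset.measurable_sum _ fun J _ => measurable_pi_apply J
    have gen : ∀ ζ : Ω → Measure Y, IsPoissonProcess ζ lam prob →
        prob.map (fun ω => I.restrict (fun t => ev (ζ ω) t)) =
          (Measure.pi fun J => prob.map (fun ω => ζ ω (A J))).map Φ := by
      intro ζ hζ
      rw [← (iIndepFun_iff_map_fun_eq_pi_map
        (fun J => (hζ.measurable_apply (hA J)).aemeasurable)).1 (hζ.indep_fintype A hA hdis),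
        Measure.map_map hΦ (measurable_pi_lambda _ fun J => hζ.measurable_apply (hA J))]
      congr 1
      ext ω i
      exact hsum (ζ ω) i
    rw [gen η h, gen η' h']
    congr 2
    ext1 J
    exact marg _ (hA J)
  ext S hS
  obtain ⟨T, hT, rfl⟩ := hle S hS
  rw [Measure.map_apply h.measurable hS, Measure.map_apply h'.measurable hS]
  have h1 := Measure.map_apply (μ := prob) (hev.comp h.measurable) hT
  have h2 := Measure.map_apply (μ := prob) (hev.comp h'.measurable) hT
  exact h1.symm.trans ((congrArg (fun m : Measure _ => m T) key).trans h2)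

end PoissonProcess

section Shift

variable {V Y Ω : Type*} [AddGroup V] [MeasurableSpace V] [MeasurableSpace Y] [AddAction V Y]
  [MeasurableVAdd V Y] [MeasurableSpace Ω]

/-- The measure `B ↦ m (B + c)`. -/
noncomputable def translate (c : V) (m : Measure Y) : Measure Y :=
  m.map (fun y => -c +ᵥ y)

lemma translate_apply (c : V) (m : Measure Y) {B : Set Y} (hB : MeasurableSet B) :
    translate c m B = m (c +ᵥ B) := by
  rw [translate, Measure.map_apply (measurable_const_vadd _) hB, Set.preimage_vadd_neg]

lemma measurable_translate (c : V) : Measurable (translate c : Measure Y → Measure Y) :=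
  Measure.measurable_map _ (measurable_const_vadd _)

variable {η : Ω → Measure Y} {lam : Measure Y} {prob : Measure Ω}

/-- Stationarity: if the intensity is invariant, `B ↦ η(B + c)` is a Poisson process with the
same intensity. -/
lemma IsPoissonProcess.isPoissonProcess_translate [VAddInvariantMeasure V Y lam]
    (h : IsPoissonProcess η lam prob) (c : V) :
    IsPoissonProcess (fun ω => translate c (η ω)) lam prob := by
  have hm : ∀ B : Set Y, MeasurableSet B → MeasurableSet (c +ᵥ B) := fun B hB => hB.const_vadd c
  refine ⟨(measurable_translate c).comp h.measurable, fun ω => ?_, fun ω B hB => ?_,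
    fun B hB ht => ?_, fun B hB ht => ?_, fun n B hB hd => ?_⟩
  · have := h.sigmaFinite ω
    exact (MeasurableEquiv.vadd (-c : V)).sigmaFinite_map
  · rw [translate_apply c _ hB]
    exact h.integerValued ω _ (hm B hB)
  · simp_rw [translate_apply c _ hB]
    rw [h.law _ (hm B hB) (by rwa [measure_vadd]), measure_vadd]
  · simp_rw [translate_apply c _ hB]
    exact h.law_top _ (hm B hB) (by rwa [measure_vadd])
  · simp_rw [fun i => fun ω => translate_apply c (η ω) (hB i)]
    refine h.indep n _ (fun i => hm _ (hB i)) fun i j hij => ?_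
    exact (Set.disjoint_vadd_set).2 (hd hij)

lemma IsPoissonProcess.measurePreserving (h : IsPoissonProcess η lam prob) :
    MeasurePreserving η prob (prob.map η) := ⟨h.measurable, rfl⟩

lemma IsPoissonProcess.measurePreserving_translate [IsProbabilityMeasure prob]
    [VAddInvariantMeasure V Y lam] (h : IsPoissonProcess η lam prob) (c : V) :
    MeasurePreserving (fun ω => translate c (η ω)) prob (prob.map η) :=
  ⟨(h.isPoissonProcess_translate c).measurable, (h.isPoissonProcess_translate c).map_eq h⟩

/-- The operator `S_c` on `L²`: it sends (the class of) `Φ(η)`, for a functional `Φ` of the process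
which is square integrable, to `Φ(η(· + c))`. Its domain of definition, the square integrable
functionals of `η`, contains every `L²(Ω, F_{a,b}, prob)`; elsewhere `shift` has the junk value
`0`. -/
noncomputable def IsPoissonProcess.shift [IsProbabilityMeasure prob]
    [VAddInvariantMeasure V Y lam] (h : IsPoissonProcess η lam prob) (c : V) :
    Lp ℂ 2 prob → Lp ℂ 2 prob :=
  Function.extend
    (Lp.compMeasurePreserving η h.measurePreserving : Lp ℂ 2 (prob.map η) → Lp ℂ 2 prob)
    (Lp.compMeasurePreserving _ (h.measurePreserving_translate c)) (fun _ => 0)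

/-- `shift` is well defined on functionals of the process. -/
lemma IsPoissonProcess.shift_comp [IsProbabilityMeasure prob]
    [VAddInvariantMeasure V Y lam] (h : IsPoissonProcess η lam prob) (c : V)
    {Φ : Measure Y → ℂ} (hΦ : MemLp Φ 2 (prob.map η)) :
    h.shift c ((hΦ.comp_measurePreserving h.measurePreserving).toLp _) =
      (hΦ.comp_measurePreserving (h.measurePreserving_translate c)).toLp _ := by
  rw [← Lp.toLp_compMeasurePreserving hΦ h.measurePreserving,
    ← Lp.toLp_compMeasurePreserving hΦ (h.measurePreserving_translate c)]
  exact (Lp.isometry_compMeasurePreserving (p := 2) (E := ℂ)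
    h.measurePreserving).injective.extend_apply _ _ _

/-- The formula `S_c (f(η(B₁), …, η(Bₙ))) = f(η(B₁ + c), …, η(Bₙ + c))`. -/
lemma IsPoissonProcess.shift_cylinder [IsProbabilityMeasure prob]
    [VAddInvariantMeasure V Y lam] (h : IsPoissonProcess η lam prob) (c : V)
    {n : ℕ} (B : Fin n → Set Y) (hB : ∀ i, MeasurableSet (B i)) {f : (Fin n → ℝ≥0∞) → ℂ}
    (hf : Measurable f) (hf2 : MemLp (fun ω => f (fun i => η ω (B i))) 2 prob) :
    ∃ hf2' : MemLp (fun ω => f (fun i => η ω (c +ᵥ B i))) 2 prob,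
      h.shift c (hf2.toLp _) = hf2'.toLp _ := by
  have hm : Measurable (fun m : Measure Y => f (fun i => m (B i))) :=
    hf.comp (measurable_pi_lambda _ fun i => Measure.measurable_coe (hB i))
  have hΦ : MemLp (fun m : Measure Y => f (fun i => m (B i))) 2 (prob.map η) :=
    (memLp_map_measure_iff hm.aestronglyMeasurable h.measurable.aemeasurable).2 hf2
  have h1 := hΦ.comp_measurePreserving (h.measurePreserving_translate c)
  have he : (fun m : Measure Y => f (fun i => m (B i))) ∘ (fun ω => translate c (η ω)) =
      fun ω => f (fun i => η ω (c +ᵥ B i)) := by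
    ext ω
    simp [translate_apply c _ (hB _)]
  refine ⟨he ▸ h1, ?_⟩
  rw [show hf2.toLp _ = (hΦ.comp_measurePreserving h.measurePreserving).toLp _ from rfl,
    h.shift_comp c hΦ]
  simp only [he]

end Shift

section Fibers

variable {V Y Ω : Type*} [AddCommGroup V] [MeasurableSpace Y] [AddAction V Y] [MeasurableSpace Ω]

/-- The complete `σ`-algebra `F_{a,b}` generated by the variables `η(B)` with `B` a measurable
subset of `(X + a) ∖ (X + b)`. -/
@[reducible] def sigmaAlg (η : Ω → Measure Y) (prob : Measure Ω) (X : Set Y) (a b : V) :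
    MeasurableSpace Ω :=
  eventuallyMeasurableSpace
    (⨆ (B : Set Y) (_ : MeasurableSet B) (_ : B ⊆ (a +ᵥ X) \ (b +ᵥ X)),
      MeasurableSpace.comap (fun ω => η ω B) inferInstance) (ae prob)

/-- The fibre `E(a) = L²(Ω, F_a, prob)`, with `F_a = F_{0,a}`, inside `L²(Ω, prob)`. -/
noncomputable def fiber (η : Ω → Measure Y) (prob : Measure Ω) (X : Set Y) (a : V) :
    Submodule ℂ (Lp ℂ 2 prob) :=
  lpMeas ℂ ℂ (sigmaAlg η prob X 0 a) 2 prob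

variable {η : Ω → Measure Y} {lam : Measure Y} {prob : Measure Ω}

/-- Every element of a space `L²(Ω, F_{a,b}, prob)` is a square integrable functional of `η`,
so that `shift` is meaningful on it. -/
lemma IsPoissonProcess.exists_functional (h : IsPoissonProcess η lam prob) {X : Set Y} {a b : V}
    {g : Lp ℂ 2 prob} (hg : g ∈ lpMeas ℂ ℂ (sigmaAlg η prob X a b) 2 prob) :
    ∃ (Φ : Measure Y → ℂ) (hΦ : MemLp Φ 2 (prob.map η)),
      g = (hΦ.comp_measurePreserving h.measurePreserving).toLp _ := by
  have hle : (⨆ (B : Set Y) (_ : MeasurableSet B) (_ : B ⊆ (a +ᵥ X) \ (b +ᵥ X)),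
      MeasurableSpace.comap (fun ω => η ω B) inferInstance) ≤
      MeasurableSpace.comap η inferInstance := by
    refine iSup_le fun B => iSup_le fun hB => iSup_le fun _ => ?_
    rintro _ ⟨t, ht, rfl⟩
    exact ⟨_, Measure.measurable_coe hB ht, rfl⟩
  obtain ⟨g', hg', hgg'⟩ := mem_lpMeas_iff_aestronglyMeasurable.1 hg
  have hU : ∀ u : TopologicalSpace.countableBasis ℂ, ∃ T : Set (Measure Y), MeasurableSet T ∧
      g' ⁻¹' u.1 =ᵐ[prob] η ⁻¹' T := by
    intro u
    obtain ⟨t, ht, htu⟩ := hg'.measurable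
      (TopologicalSpace.isOpen_of_mem_countableBasis u.2).measurableSet
    obtain ⟨T, hT, rfl⟩ := hle t ht
    exact ⟨T, hT, htu⟩
  choose T hT hTu using hU
  have hN : ∀ᵐ ω ∂prob, ∀ u : TopologicalSpace.countableBasis ℂ,
      (g' ω ∈ u.1 ↔ η ω ∈ T u) := by
    rw [ae_all_iff]
    intro u
    filter_upwards [hTu u] with ω hω
    exact iff_of_eq hω
  let N : Set Ω := {ω | ∀ u : TopologicalSpace.countableBasis ℂ, (g' ω ∈ u.1 ↔ η ω ∈ T u)}
  have hmeas : @Measurable N ℂ (MeasurableSpace.comap (fun ω : N => η ω.1) inferInstance) _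
      (fun ω : N => g' ω.1) := by
    have hb : Complex.measurableSpace =
        MeasurableSpace.generateFrom (TopologicalSpace.countableBasis ℂ) := by
      rw [← (TopologicalSpace.isBasis_countableBasis ℂ).borel_eq_generateFrom]
      exact BorelSpace.measurable_eq
    rw [hb]
    refine @measurable_generateFrom _ _ (_) _ _ ?_
    intro u hu
    refine ⟨T ⟨u, hu⟩, hT _, ?_⟩
    ext ω
    exact (ω.2 ⟨u, hu⟩).symm
  obtain ⟨Φ, hΦ, hΦe⟩ := hmeas.exists_eq_measurable_comp
  have hae : g =ᵐ[prob] Φ ∘ η := by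
    filter_upwards [hgg', hN] with ω h1 h2
    rw [h1]
    exact congrFun hΦe (⟨ω, h2⟩ : N)
  have hL : MemLp Φ 2 (prob.map η) :=
    (memLp_map_measure_iff hΦ.aestronglyMeasurable h.measurable.aemeasurable).2
      ((memLp_congr_ae hae).1 (Lp.memLp g))
  refine ⟨Φ, hL, ?_⟩
  apply Lp.ext
  exact hae.trans (MemLp.coeFn_toLp _).symm

variable [MeasurableSpace V] [MeasurableVAdd V Y]

/-- The product of `v ∈ E(b)` and `w ∈ E(c)` in the product system: `(b, v)(c, w)` is the element
`v · S_b w` (a class of functions modulo almost sure equality) of the fibre over `b + c`. -/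
noncomputable def IsPoissonProcess.mul [IsProbabilityMeasure prob] [VAddInvariantMeasure V Y lam]
    (h : IsPoissonProcess η lam prob) (b : V) (v w : Lp ℂ 2 prob) : Ω →ₘ[prob] ℂ :=
  (v : Ω →ₘ[prob] ℂ) * (h.shift b w : Ω →ₘ[prob] ℂ)

/-- `u` is a decomposable vector of `E(a)`: it is a nonzero vector of `E(a)` such that for every
`b ∈ P` with `b ≤ a` (that is, `a - b ∈ P`) it is a product of a vector of `E(b)` and a vector of
`E(a - b)`. -/
def IsPoissonProcess.IsDecomposable [IsProbabilityMeasure prob] [VAddInvariantMeasure V Y lam]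
    (h : IsPoissonProcess η lam prob) (P : Set V) (X : Set Y) (a : V) (u : Lp ℂ 2 prob) : Prop :=
  u ∈ fiber η prob X a ∧ u ≠ 0 ∧
    ∀ b ∈ P, a - b ∈ P → ∃ v ∈ fiber η prob X b, ∃ w ∈ fiber η prob X (a - b),
      (u : Ω →ₘ[prob] ℂ) = h.mul b v w

end Fibers

section Exponential

variable {Y Ω : Type*} [MeasurableSpace Y] [MeasurableSpace Ω]

/-- A measurable logarithm on `ℂ ∖ {0}` which extends the real logarithm on `(0, ∞)`
(the value at `0` is irrelevant). -/
structure IsMeasurableLog (ℓ : ℂ → ℂ) : Prop where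
  measurable : Measurable ℓ
  exp_log : ∀ z, z ≠ 0 → Complex.exp (ℓ z) = z
  ofReal : ∀ x : ℝ, 0 < x → ℓ x = Real.log x

/-- The space `L²(S, lam)`, realised as the space of those elements of `L²(Y, lam)` which vanish
almost everywhere outside `S`. -/
def L2On (lam : Measure Y) (S : Set Y) : Submodule ℂ (Lp ℂ 2 lam) where
  carrier := {f | ∀ᵐ y ∂lam, y ∉ S → f y = 0}
  zero_mem' := by
    filter_upwards [Lp.coeFn_zero ℂ 2 lam] with y hy _
    rw [hy]; rfl
  add_mem' {f g} hf hg := by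
    filter_upwards [hf, hg, Lp.coeFn_add f g] with y h1 h2 h3 hy
    rw [h3, Pi.add_apply, h1 hy, h2 hy, add_zero]
  smul_mem' c f hf := by
    filter_upwards [hf, Lp.coeFn_smul c f] with y h1 h2 hy
    rw [h2, Pi.smul_apply, h1 hy, smul_zero]

/-- The class `𝒮` of square integrable simple functions on `X` (extended by `0` to `Y`) which do
not take the value `-1`. -/
structure SimpleClass (lam : Measure Y) (X : Set Y) (f : SimpleFunc Y ℂ) : Prop where
  eq_zero : ∀ y ∉ X, f y = 0
  memLp : MemLp f 2 lam
  ne_neg_one : ∀ y ∈ X, f y ≠ -1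

/-- The random variable `Σ_f = exp(η(u_f)) / 𝔼 exp(η(u_f))`, `u_f = ℓ(1 + f)`, for `f ∈ 𝒮`. -/
noncomputable def expRV (ℓ : ℂ → ℂ) (η : Ω → Measure Y) (prob : Measure Ω) (f : SimpleFunc Y ℂ)
    (ω : Ω) : ℂ :=
  Complex.exp (∫ y, ℓ (1 + f y) ∂(η ω)) / ∫ ω', Complex.exp (∫ y, ℓ (1 + f y) ∂(η ω')) ∂prob

variable {η : Ω → Measure Y} {lam : Measure Y} {prob : Measure Ω} {ℓ : ℂ → ℂ} {X : Set Y}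

lemma IsPoissonProcess.exp_apply (h : IsPoissonProcess η lam prob) {B : Set Y}
    (hB : MeasurableSet B) (hfin : lam B ≠ ∞) (z : ℂ) :
    Integrable (fun ω => Complex.exp ((η ω B).toReal * z)) prob ∧
      ∫ ω, Complex.exp ((η ω B).toReal * z) ∂prob =
        Complex.exp (((lam B).toReal : ℂ) * (Complex.exp z - 1)) := by
  have hF : Measurable (fun x : ℝ≥0∞ => Complex.exp ((x.toReal : ℂ) * z)) := by fun_prop
  have hm := h.measurable_apply hB
  set r : ℝ≥0 := (lam B).toNNReal with hr
  have hrr : (lam B).toReal = (r : ℝ) := rfl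
  have hint : Integrable (fun k : ℕ => Complex.exp ((k : ℂ) * z)) (poissonMeasure r) := by
    rw [integrable_poissonMeasure_iff]
    have := (Real.summable_pow_div_factorial (r * ‖Complex.exp z‖)).mul_left (Real.exp (-r))
    refine this.congr fun k => ?_
    rw [Complex.exp_nat_mul, norm_pow, mul_pow]
    ring
  constructor
  · have : Integrable (fun x : ℝ≥0∞ => Complex.exp ((x.toReal : ℂ) * z))
        (prob.map (fun ω => η ω B)) := by
      rw [h.law B hB hfin, integrable_map_measure hF.aestronglyMeasurable
        Measurable.of_discrete.aemeasurable]
      simpa [Function.comp_def] using hint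
    exact (integrable_map_measure hF.aestronglyMeasurable hm.aemeasurable).1 this
  · rw [← integral_map (f := fun x : ℝ≥0∞ => Complex.exp ((x.toReal : ℂ) * z)) hm.aemeasurable
      hF.aestronglyMeasurable, h.law B hB hfin,
      integral_map Measurable.of_discrete.aemeasurable hF.aestronglyMeasurable]
    simp only [ENNReal.toReal_natCast, Complex.ofReal_natCast]
    rw [integral_poissonMeasure' hint, hrr]
    have h1 : ∀ k : ℕ, (Real.exp (-r) * (r : ℝ) ^ k / (k.factorial : ℝ)) • Complex.exp (k * z) =
        Complex.exp (-(r : ℝ)) * (((r : ℝ) * Complex.exp z) ^ k / k.factorial) := by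
      intro k
      rw [Complex.exp_nat_mul, Complex.real_smul]
      push_cast
      ring
    simp_rw [hr] at h1 ⊢
    simp_rw [h1]
    rw [tsum_mul_left, (NormedSpace.expSeries_div_hasSum_exp
      (((lam B).toNNReal : ℝ) * Complex.exp z)).tsum_eq, ← Complex.exp_eq_exp_ℂ, ← Complex.exp_add]
    congr 1
    ring

/-- The integral of a simple integrable function against the process. -/
lemma IsPoissonProcess.ae_integral_eq (h : IsPoissonProcess η lam prob) {v : SimpleFunc Y ℂ}
    (hv : Integrable v lam) :
    ∀ᵐ ω ∂prob, Integrable v (η ω) ∧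
      ∫ y, v y ∂(η ω) = ∑ z : v.range, ((η ω (v ⁻¹' {z.1})).toReal : ℂ) * z.1 := by
  have hfin := SimpleFunc.integrable_iff.1 hv
  have h1 : ∀ᵐ ω ∂prob, ∀ z : v.range, z.1 ≠ 0 → η ω (v ⁻¹' {z.1}) < ∞ := by
    rw [ae_all_iff]
    intro z
    by_cases hz : z.1 = 0
    · simp [hz]
    · have hB := v.measurableSet_fiber z.1
      have hl := h.law _ hB (hfin _ hz).ne
      have h0 : prob.map (fun ω => η ω (v ⁻¹' {z.1})) {∞} = 0 := by
        rw [hl, Measure.map_apply Measurable.of_discrete (measurableSet_singleton _)]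
        have : (fun k : ℕ => (k : ℝ≥0∞)) ⁻¹' {∞} = ∅ := by ext; simp
        rw [this, measure_empty]
      rw [Measure.map_apply (h.measurable_apply hB) (measurableSet_singleton _)] at h0
      have h2 : ∀ᵐ ω ∂prob, η ω (v ⁻¹' {z.1}) ≠ ∞ := by
        rw [ae_iff]
        simpa [Set.preimage] using h0
      filter_upwards [h2] with ω hω _
      exact lt_top_iff_ne_top.2 hω
  filter_upwards [h1] with ω hω
  have hint : Integrable v (η ω) := by
    rw [SimpleFunc.integrable_iff]
    intro z hz
    by_cases hzr : z ∈ v.range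
    · exact hω ⟨z, hzr⟩ hz
    · rw [SimpleFunc.preimage_eq_empty_iff v z |>.2 (by simpa using hzr), measure_empty]
      exact ENNReal.zero_lt_top
  refine ⟨hint, ?_⟩
  rw [← SimpleFunc.integral_eq_integral _ hint, SimpleFunc.integral_eq]
  rw [← Finset.sum_coe_sort v.range (fun z => (η ω).real (v ⁻¹' {z}) • z)]
  refine Finset.sum_congr rfl fun z _ => ?_
  rw [Complex.real_smul]
  rfl

/-- `𝔼 exp(η(v)) = exp ∫ (exp(v) - 1)` for integrable simple functions `v`. -/
lemma IsPoissonProcess.exp_integral [IsProbabilityMeasure prob] (h : IsPoissonProcess η lam prob)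
    {v : SimpleFunc Y ℂ} (hv : Integrable v lam) :
    Integrable (fun ω => Complex.exp (∫ y, v y ∂(η ω))) prob ∧
      ∫ ω, Complex.exp (∫ y, v y ∂(η ω)) ∂prob =
        Complex.exp (∫ y, (Complex.exp (v y) - 1) ∂lam) := by
  have hfin := SimpleFunc.integrable_iff.1 hv
  have hB : ∀ z : v.range, MeasurableSet (v ⁻¹' {z.1}) := fun z => v.measurableSet_fiber z.1
  have hX : ∀ z : v.range, AEMeasurable (fun ω => η ω (v ⁻¹' {z.1})) prob :=
    fun z => (h.measurable_apply (hB z)).aemeasurable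
  have hind := h.indep_fintype (fun z : v.range => v ⁻¹' {z.1}) hB (by
    intro z w hzw
    rw [Function.onFun, Set.disjoint_left]
    intro y hy hy'
    exact hzw (Subtype.ext (hy.symm.trans hy')))
  let F : v.range → ℝ≥0∞ → ℂ := fun z x => Complex.exp ((x.toReal : ℂ) * z.1)
  have hF : ∀ z, Measurable (F z) := fun z => by fun_prop
  have hone : ∀ z : v.range, Integrable (fun ω => F z (η ω (v ⁻¹' {z.1}))) prob ∧
      ∫ ω, F z (η ω (v ⁻¹' {z.1})) ∂prob =
        Complex.exp (((lam (v ⁻¹' {z.1})).toReal : ℂ) * (Complex.exp z.1 - 1)) := by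
    intro z
    by_cases hz : z.1 = 0
    · simp [F, hz]
    · exact h.exp_apply (hB z) (hfin _ hz).ne z.1
  have hae : (fun ω => Complex.exp (∫ y, v y ∂(η ω))) =ᵐ[prob]
      fun ω => ∏ z, F z (η ω (v ⁻¹' {z.1})) := by
    filter_upwards [h.ae_integral_eq hv] with ω hω
    rw [hω.2, Complex.exp_sum]
  constructor
  · refine Integrable.congr ?_ hae.symm
    have hpi : Integrable (fun x : v.range → ℝ≥0∞ => ∏ z, F z (x z))
        (Measure.pi fun z => prob.map (fun ω => η ω (v ⁻¹' {z.1}))) := by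
      have : ∀ z : v.range, IsProbabilityMeasure (prob.map (fun ω => η ω (v ⁻¹' {z.1}))) :=
        fun z => Measure.isProbabilityMeasure_map (hX z)
      refine Integrable.fintype_prod_dep fun z => ?_
      exact (integrable_map_measure (hF z).aestronglyMeasurable (hX z)).2 (hone z).1
    rw [← hind.map_fun_eq_pi_map hX] at hpi
    exact (integrable_map_measure hpi.aestronglyMeasurable (aemeasurable_pi_lambda _ hX)).1 hpi
  · rw [integral_congr_ae hae,
      hind.integral_fun_prod_comp hX (fun z => (hF z).aestronglyMeasurable)]
    simp_rw [fun z => (hone z).2]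
    rw [← Complex.exp_sum]
    congr 1
    have h0 : (fun z : ℂ => Complex.exp z - 1) 0 = 0 := by simp
    have hi : Integrable (v.map (fun z : ℂ => Complex.exp z - 1)) lam := by
      rw [SimpleFunc.integrable_iff_finMeasSupp] at hv ⊢
      exact hv.map h0
    have := SimpleFunc.map_integral v (fun z : ℂ => Complex.exp z - 1) hv h0
    rw [SimpleFunc.integral_eq_integral _ hi] at this
    simp only [SimpleFunc.coe_map, Function.comp_apply] at this
    rw [this, ← Finset.sum_coe_sort v.range
      (fun z => lam.real (v ⁻¹' {z}) • (Complex.exp z - 1))]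
    refine Finset.sum_congr rfl fun z _ => ?_
    rw [Complex.real_smul]
    rfl

lemma IsMeasurableLog.one (hℓ : IsMeasurableLog ℓ) : ℓ 1 = 0 := by
  simpa using hℓ.ofReal 1 one_pos

lemma SimpleClass.one_add_ne (f : SimpleFunc Y ℂ) (hf : SimpleClass lam X f) (y : Y) :
    1 + f y ≠ 0 := by
  intro h0
  by_cases hy : y ∈ X
  · exact hf.ne_neg_one y hy (by linear_combination h0)
  · rw [hf.eq_zero y hy] at h0
    simp at h0

lemma SimpleClass.integrable {f : SimpleFunc Y ℂ} (hf : SimpleClass lam X f) :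
    Integrable f lam := by
  have := hf.memLp
  rw [SimpleFunc.memLp_iff_finMeasSupp (by simp) (by simp)] at this
  exact SimpleFunc.integrable_iff_finMeasSupp.2 this

lemma SimpleClass.integrable_log {f : SimpleFunc Y ℂ} (hf : SimpleClass lam X f)
    (hℓ : IsMeasurableLog ℓ) : Integrable (f.map (fun z => ℓ (1 + z))) lam := by
  have := hf.integrable
  rw [SimpleFunc.integrable_iff_finMeasSupp] at this ⊢
  exact this.map (by simp [hℓ.one])

/-- The normalisation in `Σ_f`. -/
lemma IsPoissonProcess.integral_exp_log [IsProbabilityMeasure prob]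
    (h : IsPoissonProcess η lam prob) (hℓ : IsMeasurableLog ℓ) {f : SimpleFunc Y ℂ}
    (hf : SimpleClass lam X f) :
    ∫ ω, Complex.exp (∫ y, ℓ (1 + f y) ∂(η ω)) ∂prob = Complex.exp (∫ y, f y ∂lam) := by
  have := (h.exp_integral (hf.integrable_log hℓ)).2
  simp only [SimpleFunc.coe_map, Function.comp_apply] at this
  rw [this]
  congr 1
  refine integral_congr_ae (Eventually.of_forall fun y => ?_)
  simp [hℓ.exp_log _ (hf.one_add_ne f y)]

/-- The correlations `𝔼 (conj Σ_f · Σ_g) = exp ∫ conj f · g`. -/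
lemma IsPoissonProcess.expRV_mul [IsProbabilityMeasure prob]
    (h : IsPoissonProcess η lam prob) (hℓ : IsMeasurableLog ℓ) {f g : SimpleFunc Y ℂ}
    (hf : SimpleClass lam X f) (hg : SimpleClass lam X g) :
    Integrable (fun ω => starRingEnd ℂ (expRV ℓ η prob f ω) * expRV ℓ η prob g ω) prob ∧
    ∫ ω, starRingEnd ℂ (expRV ℓ η prob f ω) * expRV ℓ η prob g ω ∂prob =
      Complex.exp (∫ y, starRingEnd ℂ (f y) * g y ∂lam) := by
  let uf := f.map (fun z => ℓ (1 + z))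
  let ug := g.map (fun z => ℓ (1 + z))
  let v : SimpleFunc Y ℂ := uf.map (starRingEnd ℂ) + ug
  have hcf : Integrable (uf.map (starRingEnd ℂ)) lam := by
    have := hf.integrable_log hℓ
    rw [SimpleFunc.integrable_iff_finMeasSupp] at this ⊢
    exact this.map (map_zero _)
  have hv : Integrable v lam := hcf.add (hg.integrable_log hℓ)
  have key := h.exp_integral hv
  have hae : (fun ω => starRingEnd ℂ (expRV ℓ η prob f ω) * expRV ℓ η prob g ω) =ᵐ[prob]
      fun ω => Complex.exp (∫ y, v y ∂(η ω)) /
        (starRingEnd ℂ (Complex.exp (∫ y, f y ∂lam)) * Complex.exp (∫ y, g y ∂lam)) := by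
    filter_upwards [h.ae_integral_eq (hf.integrable_log hℓ),
      h.ae_integral_eq (hg.integrable_log hℓ)] with ω h1 h2
    have h3 : ∫ y, v y ∂(η ω) =
        starRingEnd ℂ (∫ y, ℓ (1 + f y) ∂(η ω)) + ∫ y, ℓ (1 + g y) ∂(η ω) := by
      rw [← integral_conj, ← integral_add]
      · rfl
      · exact (LinearIsometryEquiv.integrable_comp_iff Complex.conjLIE).2 h1.1
      · exact h2.1
    rw [expRV, expRV, h.integral_exp_log hℓ hf, h.integral_exp_log hℓ hg, h3, Complex.exp_add,
      map_div₀, ← Complex.exp_conj, div_mul_div_comm]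
  refine ⟨(key.1.div_const _).congr hae.symm, ?_⟩
  rw [integral_congr_ae hae, integral_div, key.2, ← Complex.exp_conj, ← Complex.exp_add,
    ← Complex.exp_sub, ← integral_conj]
  congr 1
  have i1 : Integrable (fun y => starRingEnd ℂ (f y)) lam :=
    (LinearIsometryEquiv.integrable_comp_iff Complex.conjLIE).2 hf.integrable
  have i2 : Integrable (fun y => starRingEnd ℂ (f y) * g y) lam := by
    have := hf.memLp.star.integrable_mul hg.memLp
    exact this
  have : ∀ y, Complex.exp (v y) - 1 =
      (starRingEnd ℂ (f y) + g y) + starRingEnd ℂ (f y) * g y := by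
    intro y
    have : Complex.exp (v y) = starRingEnd ℂ (1 + f y) * (1 + g y) := by
      have e : v y = starRingEnd ℂ (ℓ (1 + f y)) + ℓ (1 + g y) := rfl
      rw [e, Complex.exp_add, Complex.exp_conj, hℓ.exp_log _ (hf.one_add_ne f y),
        hℓ.exp_log _ (hg.one_add_ne g y)]
    rw [this, map_add, map_one]
    ring
  simp_rw [this]
  have e1 := integral_add (i1.add hg.integrable) i2
  have e2 := integral_add i1 hg.integrable
  simp only [Pi.add_apply] at e1
  rw [e1, e2]
  ring

lemma IsPoissonProcess.memLp_expRV [IsProbabilityMeasure prob]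
    (h : IsPoissonProcess η lam prob) (hℓ : IsMeasurableLog ℓ) {f : SimpleFunc Y ℂ}
    (hf : SimpleClass lam X f) : MemLp (expRV ℓ η prob f) 2 prob := by
  have h1 := (h.exp_integral (hf.integrable_log hℓ)).1.aestronglyMeasurable
  have h2 : AEStronglyMeasurable (expRV ℓ η prob f) prob := by
    unfold expRV
    simp_rw [div_eq_mul_inv]
    exact h1.mul_const _
  rw [memLp_two_iff_integrable_sq_norm h2]
  refine (h.expRV_mul hℓ hf hf).1.norm.congr (Eventually.of_forall fun ω => ?_)
  simp [sq]

/-- The vector `Σ_f ∈ L²(Ω, prob)`, for `f ∈ L²(X, lam)`: the limit of `Σ_g` as `g ∈ 𝒮` tends to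
`f` in `L²`. -/
noncomputable def IsPoissonProcess.expVector [IsProbabilityMeasure prob]
    (h : IsPoissonProcess η lam prob) (hℓ : IsMeasurableLog ℓ) (X : Set Y) (f : Lp ℂ 2 lam) :
    Lp ℂ 2 prob :=
  limUnder (comap (fun g : {g : SimpleFunc Y ℂ // SimpleClass lam X g} => g.2.memLp.toLp g.1) (𝓝 f))
    (fun g => (h.memLp_expRV hℓ g.2).toLp (expRV ℓ η prob g.1))

lemma IsPoissonProcess.inner_expRV [IsProbabilityMeasure prob]
    (h : IsPoissonProcess η lam prob) (hℓ : IsMeasurableLog ℓ) {f g : SimpleFunc Y ℂ}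
    (hf : SimpleClass lam X f) (hg : SimpleClass lam X g) :
    inner ℂ ((h.memLp_expRV hℓ hf).toLp (expRV ℓ η prob f))
      ((h.memLp_expRV hℓ hg).toLp (expRV ℓ η prob g)) =
      Complex.exp (inner ℂ (hf.memLp.toLp f) (hg.memLp.toLp g)) := by
  rw [L2.inner_def, L2.inner_def]
  have e1 : ∫ ω, inner ℂ ((h.memLp_expRV hℓ hf).toLp (expRV ℓ η prob f) ω)
      ((h.memLp_expRV hℓ hg).toLp (expRV ℓ η prob g) ω) ∂prob =
      ∫ ω, starRingEnd ℂ (expRV ℓ η prob f ω) * expRV ℓ η prob g ω ∂prob := by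
    refine integral_congr_ae ?_
    filter_upwards [MemLp.coeFn_toLp (h.memLp_expRV hℓ hf),
      MemLp.coeFn_toLp (h.memLp_expRV hℓ hg)] with ω h1 h2
    rw [h1, h2, RCLike.inner_apply, mul_comm]
  have e2 : ∫ y, inner ℂ (hf.memLp.toLp f y) (hg.memLp.toLp g y) ∂lam =
      ∫ y, starRingEnd ℂ (f y) * g y ∂lam := by
    refine integral_congr_ae ?_
    filter_upwards [MemLp.coeFn_toLp hf.memLp, MemLp.coeFn_toLp hg.memLp] with y h1 h2
    rw [h1, h2, RCLike.inner_apply, mul_comm]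
  rw [e1, e2, (h.expRV_mul hℓ hf hg).2]

/-- `𝒮` is dense in `L²(X, lam)`. -/
lemma exists_simpleClass (hX : MeasurableSet X) {f : Lp ℂ 2 lam} (hf : f ∈ L2On lam X)
    {ε : ℝ} (hε : 0 < ε) :
    ∃ (g : SimpleFunc Y ℂ) (hg : SimpleClass lam X g), ‖hg.memLp.toLp g - f‖ < ε := by
  obtain ⟨s, hs, hs2⟩ := (Lp.memLp f).exists_simpleFunc_eLpNorm_sub_lt (by simp)
    (ENNReal.ofReal_pos.2 (half_pos hε)).ne'
  let t : SimpleFunc Y ℂ := s.restrict X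
  have htval : ∀ y, t y = X.indicator s y := fun y => by
    rw [← SimpleFunc.coe_restrict s hX]
  have ht2 : MemLp t 2 lam := by
    rw [SimpleFunc.coe_restrict s hX]
    exact hs2.indicator hX
  have hle : eLpNorm (⇑f - ⇑t) 2 lam ≤ eLpNorm (⇑f - ⇑s) 2 lam := by
    refine eLpNorm_mono_ae ?_
    filter_upwards [hf] with y hy
    simp only [Pi.sub_apply, htval]
    by_cases hyX : y ∈ X
    · rw [Set.indicator_of_mem hyX]
    · rw [Set.indicator_of_notMem hyX, hy hyX, sub_zero, norm_zero]
      exact norm_nonneg _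
  have hclose : ‖ht2.toLp t - f‖ < ε / 2 := by
    rw [norm_sub_rev, Lp.norm_def]
    refine ENNReal.toReal_lt_of_lt_ofReal ?_
    refine lt_of_le_of_lt (le_of_eq_of_le (eLpNorm_congr_ae ?_) hle) hs
    filter_upwards [Lp.coeFn_sub f (ht2.toLp t), ht2.coeFn_toLp] with y h1 h2
    rw [h1, Pi.sub_apply, Pi.sub_apply, h2]
  -- rescale so that the value `-1` is avoided
  have hbad : (((fun z : ℂ => (-1 / z - 1).re) '' (t.range : Set ℂ))).Finite :=
    (Finset.finite_toSet _).image _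
  let δ₀ : ℝ := ε / (2 * (‖ht2.toLp t‖ + 1))
  have hδ₀ : 0 < δ₀ := by positivity
  obtain ⟨δ, hδ, hδb⟩ := (Set.Ioo_infinite hδ₀).exists_notMem_finite hbad
  let g : SimpleFunc Y ℂ := t.map (fun z => ((1 + δ : ℝ) : ℂ) * z)
  have hgval : ∀ y, g y = ((1 + δ : ℝ) : ℂ) * t y := fun y => rfl
  have hg2 : MemLp g 2 lam := ht2.const_mul _
  refine ⟨g, ⟨fun y hy => ?_, hg2, fun y hy h1 => ?_⟩, ?_⟩
  · rw [hgval, htval, Set.indicator_of_notMem hy, mul_zero]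
  · rw [hgval] at h1
    refine hδb ⟨t y, SimpleFunc.mem_range_self t y, ?_⟩
    have hne : t y ≠ 0 := by
      intro h0
      rw [h0] at h1
      simp at h1
    have : -1 / t y - 1 = (δ : ℂ) := by
      rw [← h1]
      field_simp
      push_cast
      ring
    simp only
    rw [this, Complex.ofReal_re]
  · have e : hg2.toLp g = ((1 + δ : ℝ) : ℂ) • ht2.toLp t := rfl
    have e2 : hg2.toLp g - f = (ht2.toLp t - f) + (δ : ℂ) • ht2.toLp t := by
      rw [e]
      push_cast
      rw [add_smul, one_smul]
      abel
    rw [e2]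
    refine (norm_add_le _ _).trans_lt ?_
    have : ‖(δ : ℂ) • ht2.toLp t‖ ≤ ε / 2 := by
      rw [norm_smul, Complex.norm_real, Real.norm_of_nonneg hδ.1.le]
      have hn : 0 ≤ ‖ht2.toLp t‖ := norm_nonneg _
      calc δ * ‖ht2.toLp t‖ ≤ δ₀ * (‖ht2.toLp t‖ + 1) := by
            gcongr
            · exact hδ.2.le
            · linarith
        _ = ε / 2 := by
            simp only [δ₀]
            field_simp
    linarith

/-- `Σ_f` is well defined: it is the limit of `Σ_{f_n}` for every sequence `f_n ∈ 𝒮` which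
converges to `f` (and there are such sequences). -/
lemma IsPoissonProcess.tendsto_expVector [IsProbabilityMeasure prob]
    (h : IsPoissonProcess η lam prob) (hℓ : IsMeasurableLog ℓ) (hX : MeasurableSet X)
    {f : Lp ℂ 2 lam} (hf : f ∈ L2On lam X) :
    let l := comap
      (fun g : {g : SimpleFunc Y ℂ // SimpleClass lam X g} => g.2.memLp.toLp g.1) (𝓝 f)
    l.NeBot ∧ Tendsto
      (fun g : {g : SimpleFunc Y ℂ // SimpleClass lam X g} =>
        (h.memLp_expRV hℓ g.2).toLp (expRV ℓ η prob g.1)) l (𝓝 (h.expVector hℓ X f)) := by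
  intro l
  let i : {g : SimpleFunc Y ℂ // SimpleClass lam X g} → Lp ℂ 2 lam :=
    fun g => g.2.memLp.toLp g.1
  let S : {g : SimpleFunc Y ℂ // SimpleClass lam X g} → Lp ℂ 2 prob :=
    fun g => (h.memLp_expRV hℓ g.2).toLp (expRV ℓ η prob g.1)
  have hne : l.NeBot := by
    rw [comap_neBot_iff]
    intro t ht
    obtain ⟨ε, hε, hb⟩ := Metric.mem_nhds_iff.1 ht
    obtain ⟨g, hg, hgf⟩ := exists_simpleClass hX hf hε
    exact ⟨⟨g, hg⟩, hb (by rwa [Metric.mem_ball, dist_eq_norm])⟩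
  refine ⟨hne, ?_⟩
  have hi : Tendsto i l (𝓝 f) := tendsto_comap
  have hS : ∀ a b, ‖S a - S b‖ ^ 2 = (Complex.exp (inner ℂ (i a) (i a))).re
      - 2 * (Complex.exp (inner ℂ (i a) (i b))).re + (Complex.exp (inner ℂ (i b) (i b))).re := by
    intro a b
    rw [@norm_sub_sq ℂ, ← @inner_self_eq_norm_sq ℂ, ← @inner_self_eq_norm_sq ℂ,
      h.inner_expRV hℓ a.2 a.2, h.inner_expRV hℓ a.2 b.2, h.inner_expRV hℓ b.2 b.2]
    rfl
  have hcau : Cauchy (map S l) := by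
    rw [cauchy_map_iff]
    refine ⟨hne, ?_⟩
    rw [tendsto_uniformity_iff_dist_tendsto_zero]
    have h1 : Tendsto (fun p : _ × _ => i p.1) (l ×ˢ l) (𝓝 f) := hi.comp tendsto_fst
    have h2 : Tendsto (fun p : _ × _ => i p.2) (l ×ˢ l) (𝓝 f) := hi.comp tendsto_snd
    have ex : ∀ {a b : _ × _ → Lp ℂ 2 lam}, Tendsto a (l ×ˢ l) (𝓝 f) →
        Tendsto b (l ×ˢ l) (𝓝 f) → Tendsto (fun p => (Complex.exp (inner ℂ (a p) (b p))).re)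
          (l ×ˢ l) (𝓝 (Complex.exp (inner ℂ f f)).re) := by
      intro a b ha hb
      exact ((Complex.continuous_re.comp Complex.continuous_exp).tendsto _).comp (ha.inner hb)
    have h3 : Tendsto (fun p : _ × _ => ‖S p.1 - S p.2‖ ^ 2) (l ×ˢ l) (𝓝 0) := by
      simp_rw [hS]
      have := ((ex h1 h1).sub ((ex h1 h2).const_mul 2)).add (ex h2 h2)
      refine this.congr' (Eventually.of_forall fun p => rfl) |>.trans (le_of_eq ?_)
      congr 1
      ring
    have h4 := (Real.continuous_sqrt.tendsto _).comp h3
    simp only [Real.sqrt_zero] at h4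
    refine h4.congr fun p => ?_
    simp [Real.sqrt_sq, dist_eq_norm]
  exact hcau.le_nhds_lim

end Exponential

end PoissonProductSystem

namespace PoissonProductSystem

/-! ### Hilbert space: maps with kernel exp⟪g, h⟫ and vectors with factorizing correlations -/

section ExponentialKernel

variable {L H : Type*} [NormedAddCommGroup L] [InnerProductSpace ℂ L]
  [NormedAddCommGroup H] [InnerProductSpace ℂ H]

/-! The vectors `Σ_f` satisfy ⟪Σ_f, Σ_g⟫ = exp⟪f, g⟫ and, for `f` supported on `A`, they are total
in the space of square integrable functionals of the process on `A` (`eq_zero_of_inner_expRV`). A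
vector `u` is therefore determined by Λ(g) = ⟪Σ_g, u⟫, and it is a nonzero multiple of some `Σ_f`
exactly when Λ(g) = c · exp⟪g, f⟫ with c ≠ 0.

Multiples of `Σ_f` are decomposable because `Σ_f` is the product of the exponential vectors of the
restrictions of `f` to a set and to its complement (`expVector_eq_mul`). The part of X ∖ (X + a)
inside X + b is the translate by `b` of X ∖ (X + (a - b)), so the second factor is `S_b` of a vector
of E(a - b).

Conversely let `u` be decomposable and use the decompositions at b = t a, 0 ≤ t ≤ 1. Functionals of
the process on disjoint sets are independent, so Λ(g) is a function of the part of `g` outside X + t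
a times a function of the part inside. Hence Λ(g)Λ(h) does not change when `g` and `h` exchange
their parts inside X + t a. The sets X + t a move continuously up to null sets: their jumps are
translates of each other, pairwise disjoint, and a σ-finite measure cannot charge uncountably many
of them (`measure_flowJump`). So every `g` splits into finitely many orthogonal pieces γ_k of small
norm (`exists_partition_restrictL2_le`). Exchanging pieces gives Λ(0) ≠ 0, and after normalising
Λ(0) = 1 one has Λ(g) = ∏ Λ(γ_k).

With Λ(γ_k) = 1 + a_k, orthogonality makes ∑ |a_k|² small, and ∑ a_k is close to ⟪I g, u⟫, where `I`
is the isometry onto the one-particle space, the derivative of the exponential map at 0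
(`exists_oneParticle_isometry`). Taking logarithms and refining gives Λ(g) = exp⟪I g, u⟫
(`inner_eq_exp_of_partition`), so f = I* u works (`exists_inner_eq_mul_exp`). -/

lemma tendsto_mul_exp_div_sub_one (z : ℂ) :
    Tendsto (fun N : ℝ => (N : ℂ) * (Complex.exp (z / N) - 1)) atTop (𝓝 z) := by
  rw [tendsto_iff_norm_sub_tendsto_zero]
  have h0 : Tendsto (fun N : ℝ => ‖z‖ ^ 2 / N) atTop (𝓝 0) := tendsto_id.const_div_atTop _
  refine squeeze_zero' (Eventually.of_forall fun _ => norm_nonneg _) ?_ h0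
  filter_upwards [eventually_ge_atTop (‖z‖ + 1)] with N hN
  have hN0 : 0 < N := by linarith [norm_nonneg z]
  have hNC : (N : ℂ) ≠ 0 := by exact_mod_cast hN0.ne'
  have hnorm : ‖z / N‖ = ‖z‖ / N := by
    rw [norm_div, Complex.norm_real, Real.norm_of_nonneg hN0.le]
  have h1 : ‖z / N‖ ≤ 1 := by
    rw [hnorm, div_le_one hN0]
    linarith
  have h2 := Complex.norm_exp_sub_one_sub_id_le h1
  have e : (N : ℂ) * (Complex.exp (z / N) - 1) - z =
      N * (Complex.exp (z / N) - 1 - z / N) := by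
    field_simp
  rw [e, norm_mul, Complex.norm_real, Real.norm_of_nonneg hN0.le]
  calc N * ‖Complex.exp (z / N) - 1 - z / N‖ ≤ N * ‖z / N‖ ^ 2 := by gcongr
    _ = ‖z‖ ^ 2 / N := by rw [hnorm]; field_simp

variable {E : L → H}

/-- The one-particle space of an exponential kernel. -/
lemma exists_oneParticle_isometry [CompleteSpace H]
    (hE : ∀ g h, inner ℂ (E g) (E h) = Complex.exp (inner ℂ g h)) :
    ∃ I : L →ₗᵢ[ℂ] H, ∀ g h, inner ℂ (E g) (I h) = inner ℂ g h := by
  -- Difference quotients of `E` at 0 in direction `h`. Their inner products are N (exp(⟪g, h⟫ / N)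
  -- - 1) with N = (n + 1)(m + 1). These tend to ⟪g, h⟫, so the quotients are Cauchy and the limits
  -- reproduce the inner product of `L`.
  let x : ℕ → L → H := fun n h => ((n + 1 : ℝ) : ℂ) • (E (((n + 1 : ℝ) : ℂ)⁻¹ • h) - E 0)
  let N : ℕ → ℕ → ℝ := fun n m => ((n : ℝ) + 1) * (m + 1)
  have hx : ∀ n m g h, inner ℂ (x n g) (x m h) =
      (N n m : ℂ) * (Complex.exp (inner ℂ g h / (N n m)) - 1) := by
    intro n m g h
    simp only [x, N, inner_smul_left, inner_smul_right, inner_sub_left, inner_sub_right, hE,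
      inner_zero_left, inner_zero_right, mul_zero, Complex.exp_zero, Complex.conj_ofReal,
      map_inv₀]
    have : ((n + 1 : ℝ) : ℂ)⁻¹ * (((m + 1 : ℝ) : ℂ)⁻¹ * inner ℂ g h) =
        inner ℂ g h / (((n + 1 : ℝ) * (m + 1 : ℝ) : ℝ) : ℂ) := by
      push_cast
      rw [div_eq_mul_inv, mul_inv]
      ring
    rw [mul_left_comm (((m + 1 : ℝ) : ℂ)⁻¹), this]
    push_cast
    ring
  have hEx : ∀ m g h, inner ℂ (E g) (x m h) =
      ((m + 1 : ℝ) : ℂ) * (Complex.exp (inner ℂ g h / ((m + 1 : ℝ) : ℂ)) - 1) := by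
    intro m g h
    simp only [x, inner_smul_right, inner_sub_right, hE, inner_zero_right, Complex.exp_zero]
    rw [div_eq_inv_mul]
  have hN1 : Tendsto (fun n : ℕ => (n : ℝ) + 1) atTop atTop :=
    tendsto_atTop_add_const_right _ _ tendsto_natCast_atTop_atTop
  have hN : Tendsto (fun p : ℕ × ℕ => N p.1 p.2) (atTop ×ˢ atTop) atTop :=
    (hN1.comp tendsto_fst).atTop_mul_atTop₀ (hN1.comp tendsto_snd)
  clear_value x N
  -- The index maps `a`, `b` are free because expanding ‖x p.1 h - x p.2 h‖² needs the pairs (1,1),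
  -- (1,2) and (2,2).
  have hlim : ∀ g h, ∀ a b : ℕ × ℕ → ℕ, Tendsto a (atTop ×ˢ atTop) atTop →
      Tendsto b (atTop ×ˢ atTop) atTop →
      Tendsto (fun p => inner ℂ (x (a p) g) (x (b p) h)) (atTop ×ˢ atTop) (𝓝 (inner ℂ g h)) := by
    intro g h a b ha hb
    simp_rw [hx]
    have h1 : Tendsto (fun p => N (a p) (b p)) (atTop ×ˢ atTop) atTop := hN.comp (ha.prodMk hb)
    have h2 := (tendsto_mul_exp_div_sub_one (inner ℂ g h)).comp h1
    exact h2
  have hcau : ∀ h, CauchySeq (fun n => x n h) := by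
    intro h
    rw [cauchySeq_iff_tendsto_dist_atTop_0, ← prod_atTop_atTop_eq]
    have h3 : Tendsto (fun p : ℕ × ℕ => ‖x p.1 h - x p.2 h‖ ^ 2) (atTop ×ˢ atTop) (𝓝 0) := by
      simp_rw [@norm_sub_sq ℂ, ← @inner_self_eq_norm_sq ℂ]
      have re : ∀ {f : ℕ × ℕ → ℂ} {z : ℂ}, Tendsto f (atTop ×ˢ atTop) (𝓝 z) →
          Tendsto (fun p => RCLike.re (f p)) (atTop ×ˢ atTop) (𝓝 (RCLike.re z)) :=
        fun hf => (RCLike.continuous_re.tendsto _).comp hf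
      have := ((re (hlim h h _ _ tendsto_fst tendsto_fst)).sub
        ((re (hlim h h _ _ tendsto_fst tendsto_snd)).const_mul 2)).add
        (re (hlim h h _ _ tendsto_snd tendsto_snd))
      refine this.trans (le_of_eq ?_)
      congr 1
      ring
    have h4 := (Real.continuous_sqrt.tendsto _).comp h3
    simp only [Real.sqrt_zero] at h4
    refine h4.congr fun p => ?_
    simp [Real.sqrt_sq, dist_eq_norm]
  choose i hi using fun h => cauchySeq_tendsto_of_complete (hcau h)
  have hii : ∀ g h, inner ℂ (i g) (i h) = inner ℂ g h := by
    intro g h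
    have h1 : Tendsto (fun p : ℕ × ℕ => inner ℂ (x p.1 g) (x p.2 h)) (atTop ×ˢ atTop)
        (𝓝 (inner ℂ (i g) (i h))) :=
      ((hi g).comp tendsto_fst).inner ((hi h).comp tendsto_snd)
    exact tendsto_nhds_unique h1 (hlim g h _ _ tendsto_fst tendsto_snd)
  have hEi : ∀ g h, inner ℂ (E g) (i h) = inner ℂ g h := by
    intro g h
    have h1 : Tendsto (fun n => inner ℂ (E g) (x n h)) atTop (𝓝 (inner ℂ (E g) (i h))) :=
      tendsto_const_nhds.inner (hi h)
    refine tendsto_nhds_unique h1 ?_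
    simp_rw [hEx]
    exact (tendsto_mul_exp_div_sub_one (inner ℂ g h)).comp hN1
  -- Linearity is forced by the inner products: the defect has norm zero.
  have hadd : ∀ g h, i (g + h) = i g + i h := by
    intro g h
    rw [← sub_eq_zero, ← inner_self_eq_zero (𝕜 := ℂ)]
    simp only [inner_sub_left, inner_sub_right, inner_add_left, inner_add_right, hii]
    ring
  have hsmul : ∀ (c : ℂ) g, i (c • g) = c • i g := by
    intro c g
    rw [← sub_eq_zero, ← inner_self_eq_zero (𝕜 := ℂ)]
    simp only [inner_sub_left, inner_sub_right, inner_smul_left, inner_smul_right, hii]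
    ring
  let I : L →ₗ[ℂ] H := { toFun := i, map_add' := hadd, map_smul' := hsmul }
  exact ⟨I.isometryOfInner hii, hEi⟩

lemma real_exp_sub_one_le {x : ℝ} (h0 : 0 ≤ x) (h1 : x ≤ 1) : Real.exp x - 1 ≤ 2 * x := by
  have := Real.norm_exp_sub_one_sub_id_le (x := x) (by rwa [Real.norm_of_nonneg h0])
  rw [Real.norm_of_nonneg h0] at this
  have h2 := (Real.le_norm_self _).trans this
  nlinarith

lemma norm_sq_sum_of_orthogonal {ι : Type*} {s : Finset ι} {e : ι → H}
    (he : ∀ k ∈ s, ∀ l ∈ s, k ≠ l → inner ℂ (e k) (e l) = 0) :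
    ‖∑ k ∈ s, e k‖ ^ 2 = ∑ k ∈ s, ‖e k‖ ^ 2 := by
  rw [← @inner_self_eq_norm_sq ℂ, sum_inner, map_sum]
  refine Finset.sum_congr rfl fun k hk => ?_
  rw [inner_sum, Finset.sum_eq_single_of_mem k hk fun l hl hlk => he k hk l hl hlk.symm,
    inner_self_eq_norm_sq]

lemma re_exp_inner_self (g : L) : (Complex.exp (inner ℂ g g)).re = Real.exp (‖g‖ ^ 2) := by
  rw [inner_self_eq_norm_sq_to_K]
  norm_cast

/-- A vector `u` for which `g ↦ ⟪E g, u⟫` is multiplicative over partitions into small pieces is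
exponential, if `E` has an exponential kernel. -/
lemma inner_eq_exp_of_partition [CompleteSpace H] {u : H}
    (hE : ∀ g h, inner ℂ (E g) (E h) = Complex.exp (inner ℂ g h))
    (I : L →ₗᵢ[ℂ] H) (hI : ∀ g h, inner ℂ (E g) (I h) = inner ℂ g h)
    (h0 : inner ℂ (E 0) u = 1) {g : L}
    (hpart : ∀ ε > 0, ∃ (n : ℕ) (γ : ℕ → L), (∑ k ∈ Finset.range n, γ k = g) ∧
      (∀ k < n, ‖γ k‖ ≤ ε) ∧ (∀ k < n, ∀ l < n, k ≠ l → inner ℂ (γ k) (γ l) = 0) ∧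
      inner ℂ (E g) u = ∏ k ∈ Finset.range n, inner ℂ (E (γ k)) u) :
    inner ℂ (E g) u = Complex.exp (inner ℂ (I g) u) := by
  -- The exponent `s` may depend on the partition. Since all these exponents tend to ⟪I g, u⟫,
  -- continuity of exp suffices and no branch of the logarithm has to be followed.
  suffices hs : ∀ δ > 0, ∃ s : ℂ, inner ℂ (E g) u = Complex.exp s ∧ ‖s - inner ℂ (I g) u‖ ≤ δ by
    choose s hs1 hs2 using fun n : ℕ => hs (1 / ((n : ℝ) + 1)) Nat.one_div_pos_of_nat
    have hlim : Tendsto s atTop (𝓝 (inner ℂ (I g) u)) := by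
      rw [tendsto_iff_norm_sub_tendsto_zero]
      exact squeeze_zero (fun _ => norm_nonneg _) hs2 tendsto_one_div_add_atTop_nhds_zero_nat
    have h1 := (Complex.continuous_exp.tendsto _).comp hlim
    refine tendsto_nhds_unique ?_ h1
    refine tendsto_const_nhds.congr fun n => ?_
    exact hs1 n
  -- In the bound, the first term controls ∑ |a k|², which dominates the error of log(1 + a k) ≈ a
  -- k; the second controls ∑ a k - ⟪I g, u⟫. The condition 2ε(‖u‖ + 1) ≤ 1/2 keeps |a k| ≤ 1/2.
  have key : ∀ ε : ℝ, 0 < ε → ε ≤ 1 → 2 * ε * (‖u‖ + 1) ≤ 1 / 2 →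
      ∃ s : ℂ, inner ℂ (E g) u = Complex.exp s ∧
        ‖s - inner ℂ (I g) u‖ ≤ 2 * ε ^ 2 * ‖u‖ ^ 2 + ε * ‖g‖ * ‖u‖ := by
    intro ε hε hε1 hε2
    obtain ⟨n, γ, hsum, hsmall, horth, hprod⟩ := hpart ε hε
    let a : ℕ → ℂ := fun k => inner ℂ (E (γ k)) u - 1
    let e : ℕ → H := fun k => E (γ k) - E 0
    have hae : ∀ k, a k = inner ℂ (e k) u := fun k => by
      simp only [a, e, inner_sub_left, h0]
    have hee : ∀ k l, inner ℂ (e k) (e l) = Complex.exp (inner ℂ (γ k) (γ l)) - 1 := fun k l => by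
      simp only [e, inner_sub_left, inner_sub_right, hE, inner_zero_left, inner_zero_right,
        Complex.exp_zero]
      ring
    have heI : ∀ k l, inner ℂ (e k) (I (γ l)) = inner ℂ (γ k) (γ l) := fun k l => by
      simp only [e, inner_sub_left, hI, inner_zero_left, sub_zero]
    have hIe : ∀ k l, inner ℂ (I (γ k)) (e l) = inner ℂ (γ k) (γ l) := fun k l => by
      rw [← inner_conj_symm, heI, inner_conj_symm]
    have hx1 : ∀ k < n, ‖γ k‖ ^ 2 ≤ ε ^ 2 := fun k hk => by
      have := hsmall k hk
      gcongr
    have hee2 : ∀ k < n, ‖e k‖ ^ 2 ≤ 2 * ε ^ 2 := by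
      intro k hk
      have h1 : ‖e k‖ ^ 2 = Real.exp (‖γ k‖ ^ 2) - 1 := by
        rw [← @inner_self_eq_norm_sq ℂ, hee, ← re_exp_inner_self]
        rfl
      rw [h1]
      have := real_exp_sub_one_le (sq_nonneg ‖γ k‖) ((hx1 k hk).trans (by nlinarith))
      linarith [hx1 k hk]
    have ha : ∀ k < n, ‖a k‖ ≤ 1 / 2 := by
      intro k hk
      have h1 : ‖e k‖ ≤ 2 * ε := by
        apply le_of_sq_le_sq _ (by positivity)
        nlinarith [hee2 k hk]
      calc ‖a k‖ ≤ ‖e k‖ * ‖u‖ := by rw [hae]; exact norm_inner_le_norm _ _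
        _ ≤ 2 * ε * (‖u‖ + 1) := by gcongr; linarith
        _ ≤ 1 / 2 := hε2
    have hne : ∀ k < n, 1 + a k ≠ 0 := by
      intro k hk h
      have h1 : a k = -1 := by linear_combination h
      have := ha k hk
      rw [h1] at this
      norm_num at this
    -- A Bessel estimate by duality: the `e k` are orthogonal, since the kernel minus 1 vanishes
    -- where ⟪γ k, γ l⟫ = 0. For y = ∑ a k • e k one has ⟪y, u⟫ = S and ‖y‖² ≤ 2ε²S, and
    -- Cauchy–Schwarz gives S² ≤ 2ε²‖u‖²S.
    have hS : ∑ k ∈ Finset.range n, ‖a k‖ ^ 2 ≤ 2 * ε ^ 2 * ‖u‖ ^ 2 := by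
      set S := ∑ k ∈ Finset.range n, ‖a k‖ ^ 2 with hSdef
      have hS0 : 0 ≤ S := Finset.sum_nonneg fun _ _ => sq_nonneg _
      let y : H := ∑ k ∈ Finset.range n, a k • e k
      have hyu : inner ℂ y u = (S : ℂ) := by
        simp only [y, sum_inner, inner_smul_left, ← hae, hSdef]
        push_cast
        refine Finset.sum_congr rfl fun k _ => ?_
        rw [Complex.conj_mul']
      have hyy : ‖y‖ ^ 2 ≤ 2 * ε ^ 2 * S := by
        have h2 : ‖y‖ ^ 2 = ∑ k ∈ Finset.range n, ‖a k • e k‖ ^ 2 :=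
          norm_sq_sum_of_orthogonal fun k hk l hl hkl => by
            rw [inner_smul_left, inner_smul_right, hee,
              horth k (Finset.mem_range.1 hk) l (Finset.mem_range.1 hl) hkl]
            simp
        rw [h2, hSdef, Finset.mul_sum]
        refine Finset.sum_le_sum fun k hk => ?_
        rw [norm_smul, mul_pow, mul_comm]
        gcongr
        exact hee2 k (Finset.mem_range.1 hk)
      have h3 : S ≤ ‖y‖ * ‖u‖ := by
        have := norm_inner_le_norm (𝕜 := ℂ) y u
        rwa [hyu, Complex.norm_real, Real.norm_of_nonneg hS0] at this
      have h4 : S * S ≤ 2 * ε ^ 2 * ‖u‖ ^ 2 * S := by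
        calc S * S ≤ (‖y‖ * ‖u‖) * (‖y‖ * ‖u‖) := by gcongr
          _ = ‖y‖ ^ 2 * ‖u‖ ^ 2 := by ring
          _ ≤ 2 * ε ^ 2 * S * ‖u‖ ^ 2 := by gcongr
          _ = _ := by ring
      rcases hS0.eq_or_lt with h5 | h5
      · rw [← h5]; positivity
      · exact le_of_mul_le_mul_right h4 h5
    -- The vector e k - I (γ k) is E (γ k) without its terms of order 0 and 1. These remainders are
    -- orthogonal, with squared norm exp x - 1 - x ≤ x² ≤ ε² x for x = ‖γ k‖².
    have hd : ‖∑ k ∈ Finset.range n, a k - inner ℂ (I g) u‖ ≤ ε * ‖g‖ * ‖u‖ := by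
      let y : H := ∑ k ∈ Finset.range n, (e k - I (γ k))
      have h1 : ∑ k ∈ Finset.range n, a k - inner ℂ (I g) u = inner ℂ y u := by
        rw [← hsum, map_sum]
        simp only [y, sum_inner, inner_sub_left, Finset.sum_sub_distrib, hae]
      have hd2 : ∀ k l, inner ℂ (e k - I (γ k)) (e l - I (γ l)) =
          Complex.exp (inner ℂ (γ k) (γ l)) - 1 - inner ℂ (γ k) (γ l) := fun k l => by
        have h2 := inner_sub_left (𝕜 := ℂ) (e k) (I (γ k)) (e l - I (γ l))
        rw [inner_sub_right (e k), inner_sub_right (I (γ k)), hee, heI, hIe, I.inner_map_map] at h2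
        rw [h2]
        ring
      have hgg : ‖g‖ ^ 2 = ∑ k ∈ Finset.range n, ‖γ k‖ ^ 2 := by
        rw [← hsum]
        exact norm_sq_sum_of_orthogonal fun k hk l hl hkl =>
          horth k (Finset.mem_range.1 hk) l (Finset.mem_range.1 hl) hkl
      have hyy : ‖y‖ ^ 2 ≤ ε ^ 2 * ‖g‖ ^ 2 := by
        have h3 : ‖y‖ ^ 2 = ∑ k ∈ Finset.range n, ‖e k - I (γ k)‖ ^ 2 :=
          norm_sq_sum_of_orthogonal fun k hk l hl hkl => by
            rw [hd2, horth k (Finset.mem_range.1 hk) l (Finset.mem_range.1 hl) hkl]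
            simp
        rw [h3, hgg, Finset.mul_sum]
        refine Finset.sum_le_sum fun k hk => ?_
        have hk' := hx1 k (Finset.mem_range.1 hk)
        have h4 := Real.norm_exp_sub_one_sub_id_le (x := ‖γ k‖ ^ 2) (by
          rw [Real.norm_of_nonneg (sq_nonneg _)]
          nlinarith)
        rw [Real.norm_of_nonneg (sq_nonneg ‖γ k‖)] at h4
        have h5 : ‖e k - I (γ k)‖ ^ 2 = Real.exp (‖γ k‖ ^ 2) - 1 - ‖γ k‖ ^ 2 := by
          rw [← @inner_self_eq_norm_sq ℂ, hd2, ← re_exp_inner_self, ← @inner_self_eq_norm_sq ℂ]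
          rfl
        rw [h5]
        refine (Real.le_norm_self _).trans (h4.trans ?_)
        rw [sq (‖γ k‖ ^ 2)]
        gcongr
      have hy : ‖y‖ ≤ ε * ‖g‖ := by
        apply le_of_sq_le_sq _ (by positivity)
        rw [mul_pow]
        exact hyy
      rw [h1]
      calc ‖inner ℂ y u‖ ≤ ‖y‖ * ‖u‖ := norm_inner_le_norm _ _
        _ ≤ _ := by gcongr
    refine ⟨∑ k ∈ Finset.range n, Complex.log (1 + a k), ?_, ?_⟩
    · rw [hprod, Complex.exp_sum]
      refine Finset.prod_congr rfl fun k hk => ?_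
      rw [Complex.exp_log (hne k (Finset.mem_range.1 hk))]
      simp [a]
    · have h1 : ∑ k ∈ Finset.range n, Complex.log (1 + a k) - inner ℂ (I g) u =
          ∑ k ∈ Finset.range n, (Complex.log (1 + a k) - a k) +
            (∑ k ∈ Finset.range n, a k - inner ℂ (I g) u) := by
        rw [Finset.sum_sub_distrib]
        ring
      rw [h1]
      refine (norm_add_le _ _).trans (add_le_add ?_ hd)
      refine (norm_sum_le _ _).trans ((Finset.sum_le_sum fun k hk => ?_).trans hS)
      have hk := ha k (Finset.mem_range.1 hk)
      refine (Complex.norm_log_one_add_sub_self_le (by linarith)).trans ?_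
      have h2 : (1 - ‖a k‖)⁻¹ ≤ 2 := by
        rw [inv_le_comm₀ (by linarith) (by norm_num)]
        linarith
      nlinarith [sq_nonneg ‖a k‖]
  intro δ hδ
  have hlim : Tendsto (fun ε : ℝ => 2 * ε ^ 2 * ‖u‖ ^ 2 + ε * ‖g‖ * ‖u‖) (𝓝[>] 0) (𝓝 0) := by
    have : Continuous (fun ε : ℝ => 2 * ε ^ 2 * ‖u‖ ^ 2 + ε * ‖g‖ * ‖u‖) := by fun_prop
    simpa using (this.tendsto 0).mono_left nhdsWithin_le_nhds
  have hlim2 : Tendsto (fun ε : ℝ => 2 * ε * (‖u‖ + 1)) (𝓝[>] 0) (𝓝 0) := by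
    have : Continuous (fun ε : ℝ => 2 * ε * (‖u‖ + 1)) := by fun_prop
    simpa using (this.tendsto 0).mono_left nhdsWithin_le_nhds
  have hone : ∀ᶠ ε : ℝ in 𝓝[>] 0, ε ≤ 1 :=
    nhdsWithin_le_nhds (eventually_le_nhds zero_lt_one)
  obtain ⟨ε, ⟨hε0, hε1⟩, hε2, hε3⟩ := (((eventually_mem_nhdsWithin (a := (0 : ℝ))
    (s := Ioi 0)).and hone).and ((hlim2.eventually_le_const (by norm_num : (0 : ℝ) < 1 / 2)).and
      (hlim.eventually_le_const hδ))).exists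
  obtain ⟨s, hs1, hs2⟩ := key ε hε0 hε1 hε2
  exact ⟨s, hs1, hs2.trans hε3⟩

/-- If `g ↦ ⟪E g, u⟫` factorizes along a continuous resolution `p` of the identity, then it is the
exponential of a bounded functional up to a nonzero constant. -/
theorem exists_inner_eq_mul_exp [CompleteSpace H] [CompleteSpace L] {u : H}
    (hE : ∀ g h, inner ℂ (E g) (E h) = Complex.exp (inner ℂ g h))
    (hcont : Continuous E) (p : ℝ → L →ₗ[ℂ] L)
    (hsymm : ∀ t g h, inner ℂ (p t g) h = inner ℂ g (p t h))
    (hpp : ∀ s t, s ≤ t → ∀ g, p s (p t g) = p s g ∧ p t (p s g) = p s g)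
    (hp0 : ∀ g, p 0 g = 0) (hp1 : ∀ g, p 1 g = g)
    (hsmall : ∀ g, ∀ ε > 0, ∃ n : ℕ, 0 < n ∧ ∀ k < n, ‖p ((k + 1 : ℕ) / n) g - p (k / n) g‖ ≤ ε)
    (hswap : ∀ t ∈ Icc (0 : ℝ) 1, ∀ g h, inner ℂ (E g) u * inner ℂ (E h) u =
      inner ℂ (E (p t g + (h - p t h))) u * inner ℂ (E (p t h + (g - p t g))) u)
    (hne : ∃ g, inner ℂ (E g) u ≠ 0) :
    ∃ c : ℂ, c ≠ 0 ∧ ∃ f : L, ∀ g, inner ℂ (E g) u = c * Complex.exp (inner ℂ g f) := by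
  have hmem : ∀ {n k : ℕ}, 0 < n → k ≤ n → ((k : ℝ) / n) ∈ Icc (0 : ℝ) 1 := fun {n k} hn hk =>
    ⟨by positivity, by rw [div_le_one (by exact_mod_cast hn)]; exact_mod_cast hk⟩
  have hle : ∀ {n k l : ℕ}, k ≤ l → (k : ℝ) / n ≤ (l : ℝ) / n := fun {n k l} h => by
    gcongr
  -- Start from a `g` with nonzero value and remove it piece by piece. By openness, removing any
  -- single small piece from `g` keeps the value nonzero; the exchange identity turns this into an
  -- induction that removes all of them.
  have hzero : inner ℂ (E 0) u ≠ 0 := by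
    obtain ⟨g, hg⟩ := hne
    have hopen : IsOpen {x : L | inner ℂ (E x) u ≠ 0} :=
      isOpen_ne_fun (hcont.inner continuous_const) continuous_const
    obtain ⟨ε, hε, hball⟩ := Metric.isOpen_iff.1 hopen g hg
    obtain ⟨n, hn, hinc⟩ := hsmall g (ε / 2) (half_pos hε)
    have hind : ∀ k ≤ n, inner ℂ (E (g - p ((k : ℝ) / n) g)) u ≠ 0 := by
      intro k
      induction k with
      | zero => intro _; simpa [hp0] using hg
      | succ k ih =>
        intro hk
        have h1 := ih (by omega)
        set s : ℝ := (k : ℝ) / n with hs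
        set t : ℝ := ((k + 1 : ℕ) : ℝ) / n with ht
        have hst : s ≤ t := hle (Nat.le_succ k)
        have h2 : inner ℂ (E (g - (p t g - p s g))) u ≠ 0 := by
          refine hball ?_
          rw [Metric.mem_ball, dist_eq_norm, sub_sub_cancel_left, norm_neg]
          exact (hinc k (by omega)).trans_lt (half_lt_self hε)
        -- The first vector has no part before `s`, and the second has no part between `s` and `t`.
        -- The part of the first before `s` joined to the part of the second after `s` is g - p t g,
        -- the next vector of the induction.
        have h3 := hswap s (hmem hn (by omega)) (g - p s g) (g - (p t g - p s g))
        have hss := (hpp s s le_rfl g).1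
        have e1 : p s (g - p s g) + ((g - (p t g - p s g)) - p s (g - (p t g - p s g))) =
            g - p t g := by
          simp only [map_sub, hss, (hpp s t hst g).1]
          abel
        rw [e1] at h3
        have h4 : inner ℂ (E (g - p s g)) u * inner ℂ (E (g - (p t g - p s g))) u ≠ 0 :=
          mul_ne_zero h1 h2
        rw [h3] at h4
        exact left_ne_zero_of_mul h4
    have := hind n le_rfl
    rw [div_self (by exact_mod_cast hn.ne'), hp1, sub_self] at this
    exact this
  set c := inner ℂ (E 0) u with hc
  obtain ⟨I, hI⟩ := exists_oneParticle_isometry hE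
  let v : H := c⁻¹ • u
  have hv : ∀ g, inner ℂ (E g) v = c⁻¹ * inner ℂ (E g) u := fun g => inner_smul_right _ _ _
  have hv0 : inner ℂ (E 0) v = 1 := by rw [hv, ← hc, inv_mul_cancel₀ hzero]
  have hmul : ∀ t ∈ Icc (0 : ℝ) 1, ∀ g,
      inner ℂ (E g) v = inner ℂ (E (p t g)) v * inner ℂ (E (g - p t g)) v := by
    intro t ht g
    -- Exchanging with 0 splits the value at `g` into the values at its two parts, up to the
    -- constant `c`, which the normalisation of `v` absorbs.
    have h1 := hswap t ht g 0
    simp only [map_zero, sub_zero, add_zero, zero_add] at h1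
    rw [hv, hv, hv]
    have : c⁻¹ * inner ℂ (E (p t g)) u * (c⁻¹ * inner ℂ (E (g - p t g)) u) =
        c⁻¹ * c⁻¹ * (inner ℂ (E (p t g)) u * inner ℂ (E (g - p t g)) u) := by ring
    rw [this, ← h1, ← hc]
    field_simp
  refine ⟨c, hzero, ContinuousLinearMap.adjoint I.toContinuousLinearMap v, fun g => ?_⟩
  rw [ContinuousLinearMap.adjoint_inner_right]
  have hexp : inner ℂ (E g) v = Complex.exp (inner ℂ (I g) v) := by
    refine inner_eq_exp_of_partition hE I hI hv0 fun ε hε => ?_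
    obtain ⟨n, hn, hinc⟩ := hsmall g ε hε
    let γ : ℕ → L := fun k => p ((k + 1 : ℕ) / n) g - p (k / n) g
    have hn1 : (n : ℝ) / n = 1 := div_self (by exact_mod_cast hn.ne')
    refine ⟨n, γ, ?_, hinc, ?_, ?_⟩
    · rw [Finset.sum_range_sub (fun k : ℕ => p ((k : ℝ) / n) g), hn1]
      simp [hp0, hp1]
    · have hlt : ∀ k l : ℕ, k < l → inner ℂ (γ k) (γ l) = 0 := by
        intro k l hkl
        have e1 : γ k = p ((k + 1 : ℕ) / n) (γ k) := by
          simp only [γ, map_sub, (hpp _ _ le_rfl g).1, (hpp _ _ (hle (Nat.le_succ k)) g).2]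
        have e2 : p ((k + 1 : ℕ) / n) (γ l) = 0 := by
          have h1 : (((k + 1 : ℕ) : ℝ) / n) ≤ (l : ℝ) / n := hle hkl
          simp only [γ, map_sub, (hpp _ _ h1 g).1,
            (hpp _ _ (h1.trans (hle (Nat.le_succ l))) g).1, sub_self]
        rw [e1, hsymm, e2, inner_zero_right]
      intro k _ l _ hkl
      rcases hkl.lt_or_gt with h | h
      · exact hlt k l h
      · rw [← inner_conj_symm, hlt l k h, map_zero]
    · have hind : ∀ k ≤ n, inner ℂ (E (p ((k : ℝ) / n) g)) v =
          ∏ j ∈ Finset.range k, inner ℂ (E (γ j)) v := by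
        intro k
        induction k with
        | zero => intro _; simp [hp0, hv0]
        | succ k ih =>
          intro hk
          rw [Finset.prod_range_succ, ← ih (by omega), hmul (k / n) (hmem hn (by omega)),
            (hpp _ _ (hle (Nat.le_succ k)) g).1]
      rw [← hind n le_rfl, hn1, hp1]
  have h2 : inner ℂ (E g) u = c * inner ℂ (E g) v := by
    rw [hv]
    field_simp
  rw [h2, hexp]
  rfl

end ExponentialKernel

/-! ### Restriction in L², supports, and measurability of exponential vectors -/

section ExponentialVectors

/-- Expanded in inner products, ‖E x - E g‖² is a continuous function of `x` that vanishes at `g`.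
-/
lemma continuous_of_exp_kernel {L H : Type*} [NormedAddCommGroup L] [InnerProductSpace ℂ L]
    [NormedAddCommGroup H] [InnerProductSpace ℂ H] {E : L → H}
    (hE : ∀ g h, inner ℂ (E g) (E h) = Complex.exp (inner ℂ g h)) : Continuous E := by
  rw [continuous_iff_continuousAt]
  intro g
  rw [ContinuousAt, tendsto_iff_norm_sub_tendsto_zero]
  have h1 : Continuous (fun x : L => (Complex.exp (inner ℂ x x)).re
      - 2 * (Complex.exp (inner ℂ x g)).re + (Complex.exp (inner ℂ g g)).re) := by
    fun_prop
  have h2 : Tendsto (fun x => ‖E x - E g‖ ^ 2) (𝓝 g) (𝓝 0) := by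
    have h3 : ∀ x, ‖E x - E g‖ ^ 2 = (Complex.exp (inner ℂ x x)).re
        - 2 * (Complex.exp (inner ℂ x g)).re + (Complex.exp (inner ℂ g g)).re := by
      intro x
      rw [@norm_sub_sq ℂ, ← @inner_self_eq_norm_sq ℂ, ← @inner_self_eq_norm_sq ℂ, hE, hE, hE]
      rfl
    simp_rw [h3]
    refine (h1.tendsto g).trans (le_of_eq ?_)
    congr 1
    ring
  have h4 := (Real.continuous_sqrt.tendsto _).comp h2
  simp only [Real.sqrt_zero] at h4
  refine h4.congr fun p => ?_
  simp [Real.sqrt_sq]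

variable {Y Ω : Type*} [MeasurableSpace Y] [MeasurableSpace Ω]

/-- Multiplication by the indicator function of `S` on `L²`. -/
noncomputable def restrictL2 (lam : Measure Y) {S : Set Y} (hS : MeasurableSet S) :
    Lp ℂ 2 lam →L[ℂ] Lp ℂ 2 lam :=
  LinearMap.mkContinuous
    { toFun := fun f => ((Lp.memLp f).indicator hS).toLp (S.indicator f)
      map_add' := fun f g => by
        rw [← MemLp.toLp_add]
        refine MemLp.toLp_congr _ _ ?_
        filter_upwards [Lp.coeFn_add f g] with y hy
        by_cases h : y ∈ S
        · simp only [Set.indicator_of_mem h, Pi.add_apply, hy]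
        · simp only [Set.indicator_of_notMem h, Pi.add_apply, add_zero]
      map_smul' := fun c f => by
        rw [RingHom.id_apply, ← MemLp.toLp_const_smul]
        refine MemLp.toLp_congr _ _ ?_
        filter_upwards [Lp.coeFn_smul c f] with y hy
        by_cases h : y ∈ S
        · simp only [Set.indicator_of_mem h, Pi.smul_apply, hy]
        · simp only [Set.indicator_of_notMem h, Pi.smul_apply, smul_zero] } 1 (fun f => by
    rw [one_mul]
    refine Lp.norm_le_norm_of_ae_le ?_
    filter_upwards [((Lp.memLp f).indicator hS).coeFn_toLp] with y hy
    simp only [LinearMap.coe_mk, AddHom.coe_mk]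
    rw [hy]
    exact norm_indicator_le_norm_self _ _)

variable {lam : Measure Y} {A S T X : Set Y}

lemma coeFn_restrictL2 (hS : MeasurableSet S) (f : Lp ℂ 2 lam) :
    restrictL2 lam hS f =ᵐ[lam] S.indicator f :=
  ((Lp.memLp f).indicator hS).coeFn_toLp

lemma inner_restrictL2 (hS : MeasurableSet S) (f g : Lp ℂ 2 lam) :
    inner ℂ (restrictL2 lam hS f) g = inner ℂ f (restrictL2 lam hS g) := by
  rw [L2.inner_def, L2.inner_def]
  refine integral_congr_ae ?_
  filter_upwards [coeFn_restrictL2 hS f, coeFn_restrictL2 hS g] with y h1 h2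
  by_cases h : y ∈ S <;> simp [h1, h2, h]

lemma restrictL2_restrictL2 (hS : MeasurableSet S) (hT : MeasurableSet T) (f : Lp ℂ 2 lam) :
    restrictL2 lam hS (restrictL2 lam hT f) = restrictL2 lam (hS.inter hT) f := by
  apply Lp.ext
  filter_upwards [coeFn_restrictL2 hS (restrictL2 lam hT f), coeFn_restrictL2 hT f,
    coeFn_restrictL2 (hS.inter hT) f] with y h1 h2 h3
  rw [h1, h3, ← Set.indicator_indicator]
  by_cases h : y ∈ S <;> simp [h, h2]

lemma restrictL2_add_compl (hS : MeasurableSet S) (f : Lp ℂ 2 lam) :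
    restrictL2 lam hS f + restrictL2 lam hS.compl f = f := by
  apply Lp.ext
  filter_upwards [coeFn_restrictL2 hS f, coeFn_restrictL2 hS.compl f,
    Lp.coeFn_add (restrictL2 lam hS f) (restrictL2 lam hS.compl f)] with y h1 h2 h3
  rw [h3, Pi.add_apply, h1, h2]
  by_cases h : y ∈ S <;> simp [h]

lemma restrictL2_eq_zero (hS : MeasurableSet S) {f : Lp ℂ 2 lam} (hf : f ∈ L2On lam A)
    (h : Disjoint A S) : restrictL2 lam hS f = 0 := by
  apply Lp.ext
  filter_upwards [coeFn_restrictL2 hS f, hf, Lp.coeFn_zero ℂ 2 lam] with y h1 h2 h3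
  rw [h1, h3, Pi.zero_apply]
  by_cases hy : y ∈ S
  · rw [Set.indicator_of_mem hy, h2 (fun hA => Set.disjoint_left.1 h hA hy)]
  · rw [Set.indicator_of_notMem hy]

lemma restrictL2_eq_self (hS : MeasurableSet S) {f : Lp ℂ 2 lam} (hf : f ∈ L2On lam A)
    (h : A ⊆ S) : restrictL2 lam hS f = f := by
  have h1 := restrictL2_add_compl hS f
  rwa [restrictL2_eq_zero hS.compl hf (disjoint_compl_right.mono_left h), add_zero] at h1

lemma restrictL2_mem (hS : MeasurableSet S) {f : Lp ℂ 2 lam} (hf : f ∈ L2On lam A) :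
    restrictL2 lam hS f ∈ L2On lam (A ∩ S) := by
  change ∀ᵐ y ∂lam, y ∉ A ∩ S → restrictL2 lam hS f y = 0
  filter_upwards [coeFn_restrictL2 hS f, hf] with y h1 h2 hy
  rw [h1]
  by_cases h : y ∈ S
  · rw [Set.indicator_of_mem h, h2 (fun hA => hy ⟨hA, h⟩)]
  · rw [Set.indicator_of_notMem h]

lemma L2On_mono (h : S ⊆ T) : L2On lam S ≤ L2On lam T := fun f hf => by
  change ∀ᵐ y ∂lam, y ∉ T → f y = 0
  filter_upwards [hf] with y hy hyT
  exact hy (fun hS => hyT (h hS))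

/-- It is the kernel of multiplication by the indicator function of the complement. Closedness gives
the completeness needed to take adjoints on this space. -/
lemma isClosed_L2On (hA : MeasurableSet A) : IsClosed (L2On lam A : Set (Lp ℂ 2 lam)) := by
  have : (L2On lam A : Set (Lp ℂ 2 lam)) = {f | restrictL2 lam hA.compl f = 0} := by
    ext f
    constructor
    · exact fun hf => restrictL2_eq_zero _ hf disjoint_compl_right
    · intro hf
      have h1 := restrictL2_add_compl hA f
      rw [Set.mem_ofPred_eq] at hf
      rw [hf, add_zero] at h1
      rw [SetLike.mem_coe, ← h1]
      change ∀ᵐ y ∂lam, y ∉ A → restrictL2 lam hA f y = 0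
      filter_upwards [coeFn_restrictL2 hA f] with y hy hyA
      rw [hy, Set.indicator_of_notMem hyA]
  rw [this]
  exact isClosed_eq (restrictL2 lam hA.compl).continuous continuous_const

lemma inner_eq_zero_of_disjoint (hS : MeasurableSet S) {f g : Lp ℂ 2 lam} (hf : f ∈ L2On lam S)
    (hg : g ∈ L2On lam T) (h : Disjoint S T) : inner ℂ f g = 0 := by
  rw [← restrictL2_eq_self hS hf subset_rfl, inner_restrictL2, restrictL2_eq_zero hS hg h.symm,
    inner_zero_right]

lemma SimpleClass.mono {f : SimpleFunc Y ℂ} (hf : SimpleClass lam A f) (h : A ⊆ X) :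
    SimpleClass lam X f := by
  refine ⟨fun y hy => hf.eq_zero y (fun hA => hy (h hA)), hf.memLp, fun y _ => ?_⟩
  by_cases hyA : y ∈ A
  · exact hf.ne_neg_one y hyA
  · rw [hf.eq_zero y hyA]
    norm_num

lemma SimpleClass.toLp_mem {f : SimpleFunc Y ℂ} (hf : SimpleClass lam A f) :
    hf.memLp.toLp f ∈ L2On lam A := by
  change ∀ᵐ y ∂lam, y ∉ A → hf.memLp.toLp f y = 0
  filter_upwards [hf.memLp.coeFn_toLp] with y hy hyA
  rw [hy, hf.eq_zero y hyA]

lemma SimpleClass.zero : SimpleClass lam A 0 :=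
  ⟨fun _ _ => rfl, MemLp.zero, fun _ _ => by norm_num [SimpleFunc.coe_zero]⟩

lemma SimpleClass.restrict {f : SimpleFunc Y ℂ} (hf : SimpleClass lam A f)
    (hS : MeasurableSet S) : SimpleClass lam (A ∩ S) (f.restrict S) := by
  have hv : ∀ y, f.restrict S y = S.indicator f y := fun y => by rw [← SimpleFunc.coe_restrict f hS]
  refine ⟨fun y hy => ?_, ?_, fun y hy => ?_⟩
  · rw [hv]
    by_cases h : y ∈ S
    · rw [Set.indicator_of_mem h, hf.eq_zero y (fun hA => hy ⟨hA, h⟩)]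
    · rw [Set.indicator_of_notMem h]
  · rw [SimpleFunc.coe_restrict f hS]
    exact hf.memLp.indicator hS
  · rw [hv, Set.indicator_of_mem hy.2]
    exact hf.ne_neg_one y hy.1

lemma SimpleClass.toLp_restrict {f : SimpleFunc Y ℂ} (hf : SimpleClass lam A f)
    (hS : MeasurableSet S) : (hf.restrict hS).memLp.toLp (f.restrict S) =
      restrictL2 lam hS (hf.memLp.toLp f) := by
  apply Lp.ext
  filter_upwards [(hf.restrict hS).memLp.coeFn_toLp, coeFn_restrictL2 hS (hf.memLp.toLp f),
    hf.memLp.coeFn_toLp] with y h1 h2 h3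
  rw [h1, h2, SimpleFunc.coe_restrict f hS]
  by_cases h : y ∈ S <;> simp [h, h3]

/-- A closed property of elements of `L²(A)` which holds for simple functions holds for all. -/
lemma L2On_induction (hA : MeasurableSet A) {p : Lp ℂ 2 lam → Prop}
    (hp : IsClosed {f : L2On lam A | p f})
    (hs : ∀ (g : SimpleFunc Y ℂ) (hg : SimpleClass lam A g), p (hg.memLp.toLp g))
    {f : Lp ℂ 2 lam} (hf : f ∈ L2On lam A) : p f := by
  have : (⟨f, hf⟩ : L2On lam A) ∈ closure {f : L2On lam A | p f} := by
    rw [Metric.mem_closure_iff]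
    intro ε hε
    obtain ⟨g, hg, hgf⟩ := exists_simpleClass hA hf hε
    refine ⟨⟨hg.memLp.toLp g, hg.toLp_mem⟩, hs g hg, ?_⟩
    rwa [Subtype.dist_eq, dist_comm, dist_eq_norm]
  rwa [hp.closure_eq] at this

variable {η : Ω → Measure Y} {prob : Measure Ω} {ℓ : ℂ → ℂ}

section Simple

variable [IsProbabilityMeasure prob]

lemma IsPoissonProcess.expVector_toLp (h : IsPoissonProcess η lam prob) (hℓ : IsMeasurableLog ℓ)
    (hX : MeasurableSet X) {f : SimpleFunc Y ℂ} (hf : SimpleClass lam X f) :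
    h.expVector hℓ X (hf.memLp.toLp f) = (h.memLp_expRV hℓ hf).toLp (expRV ℓ η prob f) := by
  have h1 := (h.tendsto_expVector hℓ hX hf.toLp_mem).2
  let g₀ : {g : SimpleFunc Y ℂ // SimpleClass lam X g} := ⟨f, hf⟩
  -- The filter that defines `expVector` is not punctured: it lies above the point `g₀` itself, so
  -- the limit has to be the value there.
  have h2 : pure g₀ ≤ comap
      (fun g : {g : SimpleFunc Y ℂ // SimpleClass lam X g} => g.2.memLp.toLp g.1)
      (𝓝 (hf.memLp.toLp f)) := by
    rw [← map_le_iff_le_comap, map_pure]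
    exact pure_le_nhds _
  have h3 := h1.mono_left h2
  exact tendsto_nhds_unique h3 (tendsto_pure_nhds _ g₀)

lemma IsPoissonProcess.inner_expVector (h : IsPoissonProcess η lam prob) (hℓ : IsMeasurableLog ℓ)
    (hX : MeasurableSet X) {f g : Lp ℂ 2 lam} (hf : f ∈ L2On lam X) (hg : g ∈ L2On lam X) :
    inner ℂ (h.expVector hℓ X f) (h.expVector hℓ X g) = Complex.exp (inner ℂ f g) := by
  obtain ⟨n1, t1⟩ := h.tendsto_expVector hℓ hX hf
  obtain ⟨n2, t2⟩ := h.tendsto_expVector hℓ hX hg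
  let i : {g : SimpleFunc Y ℂ // SimpleClass lam X g} → Lp ℂ 2 lam :=
    fun g => g.2.memLp.toLp g.1
  have h1 := Tendsto.inner (𝕜 := ℂ) (t1.comp (tendsto_fst (g := comap i (𝓝 g))))
    (t2.comp (tendsto_snd (f := comap i (𝓝 f))))
  have h2 := Tendsto.inner (𝕜 := ℂ)
    ((tendsto_comap (f := i) (x := 𝓝 f)).comp (tendsto_fst (g := comap i (𝓝 g))))
    ((tendsto_comap (f := i) (x := 𝓝 g)).comp (tendsto_snd (f := comap i (𝓝 f))))
  have h3 := (Complex.continuous_exp.tendsto _).comp h2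
  refine tendsto_nhds_unique h1 (h3.congr fun p => ?_)
  simp only [Function.comp_apply]
  rw [h.inner_expRV hℓ p.1.2 p.2.2]

lemma IsPoissonProcess.continuous_expVector (h : IsPoissonProcess η lam prob)
    (hℓ : IsMeasurableLog ℓ) (hX : MeasurableSet X) :
    Continuous (fun f : L2On lam X => h.expVector hℓ X f) :=
  continuous_of_exp_kernel fun f g => h.inner_expVector hℓ hX f.2 g.2

lemma IsPoissonProcess.continuous_expVector_of_subset (h : IsPoissonProcess η lam prob)
    (hℓ : IsMeasurableLog ℓ) (hX : MeasurableSet X) (hA : A ⊆ X) :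
    Continuous (fun f : L2On lam A => h.expVector hℓ X f) :=
  (h.continuous_expVector hℓ hX).comp (f := fun f : L2On lam A =>
    (⟨f, L2On_mono hA f.2⟩ : L2On lam X)) (by fun_prop)

end Simple

/-- The `σ`-algebra generated by the variables `η(B)` with `B ⊆ A`. -/
@[reducible] def sigmaGen (η : Ω → Measure Y) (A : Set Y) : MeasurableSpace Ω :=
  ⨆ (B : Set Y) (_ : MeasurableSet B) (_ : B ⊆ A),
    MeasurableSpace.comap (fun ω => η ω B) inferInstance

/-- The complete `σ`-algebra generated by the variables `η(B)` with `B ⊆ A`. -/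
@[reducible] def sigmaOn (η : Ω → Measure Y) (prob : Measure Ω) (A : Set Y) : MeasurableSpace Ω :=
  eventuallyMeasurableSpace (sigmaGen η A) (ae prob)

omit [MeasurableSpace Ω] in
lemma measurable_sigmaGen {B : Set Y} (hB : MeasurableSet B) (hBA : B ⊆ A) :
    @Measurable Ω ℝ≥0∞ (sigmaGen η A) _ (fun ω => η ω B) := by
  have h1 : MeasurableSpace.comap (fun ω => η ω B) inferInstance ≤ sigmaGen η A :=
    le_iSup_of_le B (le_iSup_of_le hB (le_iSup_of_le hBA le_rfl))
  exact Measurable.mono (comap_measurable _) h1 le_rfl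

omit [MeasurableSpace Ω] in
lemma sigmaGen_mono (h : A ⊆ X) : sigmaGen η A ≤ sigmaGen η X :=
  iSup_le fun _ => iSup_le fun hB => iSup_le fun hBA =>
    (measurable_sigmaGen hB (hBA.trans h)).comap_le

lemma sigmaOn_mono (h : A ⊆ X) : sigmaOn η prob A ≤ sigmaOn η prob X := by
  rintro s ⟨t, ht, hst⟩
  exact ⟨t, sigmaGen_mono h t ht, hst⟩

lemma IsPoissonProcess.sigmaGen_le (h : IsPoissonProcess η lam prob) :
    sigmaGen η A ≤ (inferInstance : MeasurableSpace Ω) :=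
  iSup_le fun _ => iSup_le fun hB => iSup_le fun _ => (h.measurable_apply hB).comap_le

/-- Sets that differ from generated ones by null sets are measurable because `prob` is complete. -/
lemma IsPoissonProcess.sigmaOn_le [prob.IsComplete] (h : IsPoissonProcess η lam prob) :
    sigmaOn η prob A ≤ (inferInstance : MeasurableSpace Ω) := by
  rintro s ⟨t, ht, hst⟩
  have h1 : NullMeasurableSet t prob := (h.sigmaGen_le t ht).nullMeasurableSet
  exact (h1.congr hst.symm).measurable_of_complete

lemma sigmaGen_le_sigmaOn : sigmaGen η A ≤ sigmaOn η prob A :=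
  fun t ht => ⟨t, ht, EventuallyEq.rfl⟩

lemma IsPoissonProcess.isClosed_lpMeas [prob.IsComplete] (h : IsPoissonProcess η lam prob) :
    IsClosed (lpMeas ℂ ℂ (sigmaOn η prob A) 2 prob : Set (Lp ℂ 2 prob)) := by
  have h1 := isClosed_aestronglyMeasurable (F := ℂ) (p := 2) (μ := prob)
    (h.sigmaOn_le (A := A) (prob := prob))
  convert h1 using 1
  ext f
  exact mem_lpMeas_iff_aestronglyMeasurable

variable [IsProbabilityMeasure prob]

/-- `Σ_f` is a function of the restriction of the process to the support of `f`. -/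
lemma IsPoissonProcess.toLp_expRV_mem (h : IsPoissonProcess η lam prob) (hℓ : IsMeasurableLog ℓ)
    {f : SimpleFunc Y ℂ} (hf : SimpleClass lam A f) :
    (h.memLp_expRV hℓ hf).toLp (expRV ℓ η prob f) ∈ lpMeas ℂ ℂ (sigmaOn η prob A) 2 prob := by
  rw [mem_lpMeas_iff_aestronglyMeasurable]
  let v := f.map (fun z => ℓ (1 + z))
  let c : ℂ := ∫ ω, Complex.exp (∫ y, ℓ (1 + f y) ∂(η ω)) ∂prob
  have hm : @Measurable Ω ℂ (sigmaGen η A) _ (fun ω => Complex.exp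
      (∑ z : v.range, ((η ω (v ⁻¹' {z.1})).toReal : ℂ) * z.1) / c) := by
    refine Measurable.div_const (Complex.measurable_exp.comp ?_) _
    refine Finset.measurable_sum _ fun z _ => ?_
    -- The level set over 0 may leave `A`, but it enters with the factor 0. All other level sets lie
    -- in `A`, because ℓ 1 = 0.
    by_cases hz : z.1 = 0
    · simp only [hz, mul_zero]
      exact measurable_const
    · refine Measurable.mul_const ?_ _
      refine Complex.measurable_ofReal.comp (ENNReal.measurable_toReal.comp ?_)
      refine measurable_sigmaGen (v.measurableSet_fiber _) fun y hy => ?_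
      by_contra hyA
      refine hz ?_
      have h1 : v y = z.1 := hy
      rw [← h1]
      simp [v, hf.eq_zero y hyA, hℓ.one]
  refine ⟨_, (hm.mono sigmaGen_le_sigmaOn le_rfl).stronglyMeasurable, ?_⟩
  filter_upwards [(h.memLp_expRV hℓ hf).coeFn_toLp, h.ae_integral_eq (hf.integrable_log hℓ)]
    with ω h1 h2
  rw [h1, expRV]
  congr 2
  exact h2.2

lemma IsPoissonProcess.expVector_mem [prob.IsComplete] (h : IsPoissonProcess η lam prob)
    (hℓ : IsMeasurableLog ℓ) (hX : MeasurableSet X) (hA : MeasurableSet A) (hAX : A ⊆ X)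
    {f : Lp ℂ 2 lam} (hf : f ∈ L2On lam A) :
    h.expVector hℓ X f ∈ lpMeas ℂ ℂ (sigmaOn η prob A) 2 prob := by
  refine L2On_induction hA (p := fun f => h.expVector hℓ X f ∈
    lpMeas ℂ ℂ (sigmaOn η prob A) 2 prob) ?_ (fun g hg => ?_) hf
  · exact h.isClosed_lpMeas.preimage (h.continuous_expVector_of_subset hℓ hX hAX)
  · rw [h.expVector_toLp hℓ hX (hg.mono hAX)]
    exact h.toLp_expRV_mem hℓ hg

end ExponentialVectors

/-! ### Multipliers of an annihilator: a functional monotone class argument -/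

section Multipliers

variable {Ω : Type*} [MeasurableSpace Ω] {μ : Measure Ω} {𝓔 : Set (Ω → ℂ)}

/-- The integrable functions which annihilate a family of test functions. -/
def annihilator (μ : Measure Ω) (𝓔 : Set (Ω → ℂ)) : Set (Ω → ℂ) :=
  {u | Integrable u μ ∧ ∀ e ∈ 𝓔, ∫ ω, u ω * e ω ∂μ = 0}

/-- The bounded functions which leave the annihilator of `𝓔` invariant. -/
structure IsMultiplier (μ : Measure Ω) (𝓔 : Set (Ω → ℂ)) (x : Ω → ℂ) : Prop where
  aestronglyMeasurable : AEStronglyMeasurable x μ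
  bdd : ∃ C : ℝ, ∀ᵐ ω ∂μ, ‖x ω‖ ≤ C
  mul_mem : ∀ u ∈ annihilator μ 𝓔, (fun ω => u ω * x ω) ∈ annihilator μ 𝓔

/-- Bounded test functions. -/
def IsTestFamily (μ : Measure Ω) (𝓔 : Set (Ω → ℂ)) : Prop :=
  ∀ e ∈ 𝓔, AEStronglyMeasurable e μ ∧ ∀ᵐ ω ∂μ, ‖e ω‖ ≤ 1

lemma IsTestFamily.integrable_mul (h𝓔 : IsTestFamily μ 𝓔) {u e : Ω → ℂ} (hu : Integrable u μ)
    (he : e ∈ 𝓔) : Integrable (fun ω => u ω * e ω) μ :=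
  hu.mul_bdd (h𝓔 e he).1 (h𝓔 e he).2

lemma IsMultiplier.congr {x y : Ω → ℂ} (hx : IsMultiplier μ 𝓔 x) (h : x =ᵐ[μ] y) :
    IsMultiplier μ 𝓔 y := by
  obtain ⟨C, hC⟩ := hx.bdd
  refine ⟨hx.aestronglyMeasurable.congr h, ⟨C, ?_⟩, fun u hu => ?_⟩
  · filter_upwards [hC, h] with ω h1 h2
    rwa [← h2]
  · have h1 := hx.mul_mem u hu
    refine ⟨h1.1.congr ?_, fun e he => ?_⟩
    · filter_upwards [h] with ω hω
      rw [hω]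
    · rw [← h1.2 e he]
      refine integral_congr_ae ?_
      filter_upwards [h] with ω hω
      rw [hω]

lemma IsMultiplier.const (c : ℂ) : IsMultiplier μ 𝓔 (fun _ => c) := by
  refine ⟨aestronglyMeasurable_const, ⟨‖c‖, by simp⟩, fun u hu => ⟨hu.1.mul_const c, ?_⟩⟩
  intro e he
  have : ∀ ω, u ω * c * e ω = c * (u ω * e ω) := fun ω => by ring
  simp_rw [this]
  rw [integral_const_mul, hu.2 e he, mul_zero]

lemma IsMultiplier.sub (h𝓔 : IsTestFamily μ 𝓔) {x y : Ω → ℂ} (hx : IsMultiplier μ 𝓔 x)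
    (hy : IsMultiplier μ 𝓔 y) : IsMultiplier μ 𝓔 (fun ω => x ω - y ω) := by
  obtain ⟨C, hC⟩ := hx.bdd
  obtain ⟨D, hD⟩ := hy.bdd
  refine ⟨hx.aestronglyMeasurable.sub hy.aestronglyMeasurable, ⟨C + D, ?_⟩, fun u hu => ?_⟩
  · filter_upwards [hC, hD] with ω h1 h2
    exact (norm_sub_le _ _).trans (add_le_add h1 h2)
  · have h1 := hx.mul_mem u hu
    have h2 := hy.mul_mem u hu
    have e1 : ∀ ω, u ω * (x ω - y ω) = u ω * x ω - u ω * y ω := fun ω => by ring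
    refine ⟨by simp_rw [e1]; exact h1.1.sub h2.1, fun e he => ?_⟩
    simp_rw [e1, sub_mul]
    rw [integral_sub (h𝓔.integrable_mul h1.1 he) (h𝓔.integrable_mul h2.1 he), h1.2 e he,
      h2.2 e he, sub_zero]

lemma IsMultiplier.mul {x y : Ω → ℂ} (hx : IsMultiplier μ 𝓔 x) (hy : IsMultiplier μ 𝓔 y) :
    IsMultiplier μ 𝓔 (fun ω => x ω * y ω) := by
  obtain ⟨C, hC⟩ := hx.bdd
  obtain ⟨D, hD⟩ := hy.bdd
  refine ⟨hx.aestronglyMeasurable.mul hy.aestronglyMeasurable, ⟨C * D, ?_⟩, fun u hu => ?_⟩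
  · filter_upwards [hC, hD] with ω h1 h2
    rw [norm_mul]
    exact mul_le_mul h1 h2 (norm_nonneg _) ((norm_nonneg _).trans h1)
  · have h1 := hy.mul_mem _ (hx.mul_mem u hu)
    simpa only [mul_assoc] using h1

lemma IsMultiplier.pow {x : Ω → ℂ} (hx : IsMultiplier μ 𝓔 x) (n : ℕ) :
    IsMultiplier μ 𝓔 (fun ω => x ω ^ n) := by
  induction n with
  | zero => simpa using IsMultiplier.const (μ := μ) (𝓔 := 𝓔) 1
  | succ n ih => simpa only [pow_succ] using ih.mul hx

/-- Dominated convergence with majorant |u|: the multipliers and the test functions are bounded by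
1. -/
lemma IsMultiplier.of_tendsto (h𝓔 : IsTestFamily μ 𝓔) {x : ℕ → Ω → ℂ} {y : Ω → ℂ}
    (hx : ∀ n, IsMultiplier μ 𝓔 (x n)) (hb : ∀ n, ∀ᵐ ω ∂μ, ‖x n ω‖ ≤ 1)
    (hlim : ∀ᵐ ω ∂μ, Tendsto (fun n => x n ω) atTop (𝓝 (y ω))) : IsMultiplier μ 𝓔 y := by
  have hym := aestronglyMeasurable_of_tendsto_ae atTop
    (fun n => (hx n).aestronglyMeasurable) hlim
  have hyb : ∀ᵐ ω ∂μ, ‖y ω‖ ≤ 1 := by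
    filter_upwards [ae_all_iff.2 hb, hlim] with ω h1 h2
    exact le_of_tendsto h2.norm (Eventually.of_forall h1)
  refine ⟨hym, ⟨1, hyb⟩, fun u hu => ⟨hu.1.mul_bdd hym hyb, fun e he => ?_⟩⟩
  have h1 : Tendsto (fun n => ∫ ω, u ω * x n ω * e ω ∂μ) atTop
      (𝓝 (∫ ω, u ω * y ω * e ω ∂μ)) := by
    refine tendsto_integral_of_dominated_convergence (fun ω => ‖u ω‖) (fun n => ?_) hu.1.norm
      (fun n => ?_) ?_
    · exact (hu.1.aestronglyMeasurable.mul (hx n).aestronglyMeasurable).mul (h𝓔 e he).1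
    · filter_upwards [hb n, (h𝓔 e he).2] with ω h2 h3
      rw [norm_mul, norm_mul]
      calc ‖u ω‖ * ‖x n ω‖ * ‖e ω‖ ≤ ‖u ω‖ * 1 * 1 := by gcongr
        _ = ‖u ω‖ := by ring
    · filter_upwards [hlim] with ω h2
      exact (tendsto_const_nhds.mul h2).mul tendsto_const_nhds
  simp_rw [((hx _).mul_mem u hu).2 e he] at h1
  exact tendsto_nhds_unique h1 tendsto_const_nhds

/-- By duality, multiplication by a function that maps test functions to test functions preserves
their annihilator. This is the source of all nontrivial multipliers below. -/
lemma IsMultiplier.of_mul_mem {x : Ω → ℂ} (hx : AEStronglyMeasurable x μ)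
    (hb : ∀ᵐ ω ∂μ, ‖x ω‖ ≤ 1) (h : ∀ e ∈ 𝓔, ∃ e' ∈ 𝓔, ∀ᵐ ω ∂μ, e' ω = x ω * e ω) :
    IsMultiplier μ 𝓔 x := by
  refine ⟨hx, ⟨1, hb⟩, fun u hu => ⟨hu.1.mul_bdd hx hb, fun e he => ?_⟩⟩
  obtain ⟨e', he', hee⟩ := h e he
  rw [← hu.2 e' he']
  refine integral_congr_ae ?_
  filter_upwards [hee] with ω hω
  rw [hω, mul_assoc]

/-- The sets whose indicator functions are multipliers form a `σ`-algebra. -/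
@[reducible] def multiplierSigma (h𝓔 : IsTestFamily μ 𝓔) : MeasurableSpace Ω where
  MeasurableSet' F := IsMultiplier μ 𝓔 (F.indicator 1)
  measurableSet_empty := by
    rw [Set.indicator_empty]
    exact IsMultiplier.const 0
  measurableSet_compl F hF := by
    refine (IsMultiplier.sub h𝓔 (IsMultiplier.const 1) hF).congr (Eventually.of_forall fun ω => ?_)
    by_cases hω : ω ∈ F <;> simp [hω]
  measurableSet_iUnion F hF := by
    have hc : ∀ n, IsMultiplier μ 𝓔 ((F n)ᶜ.indicator 1) := fun n => by
      refine (IsMultiplier.sub h𝓔 (IsMultiplier.const 1) (hF n)).congr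
        (Eventually.of_forall fun ω => ?_)
      by_cases hω : ω ∈ F n <;> simp [hω]
    -- The union need not be disjoint, so one passes to complements: indicators of finite
    -- intersections are products, and the countable intersection is their bounded limit.
    have hfin : ∀ n : ℕ, IsMultiplier μ 𝓔 ((⋂ k ∈ Finset.range n, (F k)ᶜ).indicator 1) := by
      intro n
      induction n with
      | zero => exact (IsMultiplier.const 1).congr (Eventually.of_forall fun ω => by simp)
      | succ n ih =>
        refine (ih.mul (hc n)).congr (Eventually.of_forall fun ω => ?_)
        rw [Finset.range_add_one, Finset.set_biInter_insert, Set.inter_comm,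
          Set.inter_indicator_one, Pi.mul_apply]
    have hlim : IsMultiplier μ 𝓔 ((⋂ k, (F k)ᶜ).indicator 1) := by
      refine IsMultiplier.of_tendsto h𝓔 hfin (fun n => Eventually.of_forall fun ω => ?_)
        (Eventually.of_forall fun ω => ?_)
      · refine (norm_indicator_le_norm_self _ _).trans ?_
        simp
      · by_cases hω : ∃ k, ω ∈ F k
        · obtain ⟨k, hk⟩ := hω
          have h1 : ω ∉ ⋂ k, (F k)ᶜ := fun h => Set.mem_iInter.1 h k hk
          rw [Set.indicator_of_notMem h1]
          refine tendsto_const_nhds.congr' ?_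
          filter_upwards [eventually_gt_atTop k] with n hn
          rw [Set.indicator_of_notMem]
          intro h2
          exact Set.mem_iInter₂.1 h2 k (Finset.mem_range.2 hn) hk
        · push Not at hω
          have h1 : ∀ n : ℕ, ω ∈ ⋂ k ∈ Finset.range n, (F k)ᶜ := fun n =>
            Set.mem_iInter₂.2 fun k _ => hω k
          simp_rw [fun n => Set.indicator_of_mem (h1 n) (1 : Ω → ℂ)]
          rw [Set.indicator_of_mem (Set.mem_iInter.2 hω)]
          exact tendsto_const_nhds
    refine (IsMultiplier.sub h𝓔 (IsMultiplier.const 1) hlim).congr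
      (Eventually.of_forall fun ω => ?_)
    rw [← Set.compl_iUnion]
    by_cases hω : ω ∈ ⋃ k, F k <;> simp only [Set.indicator, Set.mem_compl_iff, hω] <;> simp

end Multipliers

/-! ### Totality of the exponential vectors, through Laplace functionals -/

section Totality

variable {Y Ω : Type*} [MeasurableSpace Y] [MeasurableSpace Ω] {lam : Measure Y}
  {A B X : Set Y} {η : Ω → Measure Y} {prob : Measure Ω} [IsProbabilityMeasure prob] {ℓ : ℂ → ℂ}

/-- Integrable simple functions with values in `(-∞, 0]` which are supported by `A`. -/
structure NonposClass (lam : Measure Y) (A : Set Y) (v : SimpleFunc Y ℂ) : Prop where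
  eq_zero : ∀ y ∉ A, v y = 0
  integrable : Integrable v lam
  nonpos : ∀ y, ∃ r : ℝ, r ≤ 0 ∧ v y = r

lemma NonposClass.simpleClass {v : SimpleFunc Y ℂ} (hv : NonposClass lam A v) :
    SimpleClass lam A (v.map (fun z => Complex.exp z - 1)) := by
  refine ⟨fun y hy => by simp [hv.eq_zero y hy], ?_, fun y _ h => ?_⟩
  · have := hv.integrable
    rw [SimpleFunc.integrable_iff_finMeasSupp] at this
    rw [SimpleFunc.memLp_iff_finMeasSupp (by simp) (by simp)]
    exact this.map (by simp)
  · simp only [SimpleFunc.coe_map, Function.comp_apply] at h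
    exact Complex.exp_ne_zero (v y) (by linear_combination h)

/-- The choice f = exp v - 1 inverts f ↦ ℓ(1 + f). Here 1 + f is positive, where `ℓ` is the real
logarithm. -/
lemma NonposClass.log_eq (hℓ : IsMeasurableLog ℓ) {v : SimpleFunc Y ℂ} (hv : NonposClass lam A v)
    (y : Y) : ℓ (1 + (v.map (fun z => Complex.exp z - 1)) y) = v y := by
  obtain ⟨r, -, hr⟩ := hv.nonpos y
  simp only [SimpleFunc.coe_map, Function.comp_apply, hr, add_sub_cancel]
  rw [← Complex.ofReal_exp, hℓ.ofReal _ (Real.exp_pos r), Real.log_exp]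

lemma NonposClass.zero : NonposClass lam A 0 :=
  ⟨fun _ _ => rfl, integrable_zero _ _ _, fun _ => ⟨0, le_rfl, by simp⟩⟩

lemma NonposClass.add {v w : SimpleFunc Y ℂ} (hv : NonposClass lam A v)
    (hw : NonposClass lam A w) : NonposClass lam A (v + w) := by
  refine ⟨fun y hy => ?_, hv.integrable.add hw.integrable, fun y => ?_⟩
  · rw [SimpleFunc.coe_add, Pi.add_apply, hv.eq_zero y hy, hw.eq_zero y hy, add_zero]
  · obtain ⟨r, hr, hr'⟩ := hv.nonpos y
    obtain ⟨s, hs, hs'⟩ := hw.nonpos y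
    refine ⟨r + s, by linarith, ?_⟩
    rw [SimpleFunc.coe_add, Pi.add_apply, hr', hs', Complex.ofReal_add]

/-- The Laplace functionals of the restriction of the process to `A`. -/
def laplaceFamily (η : Ω → Measure Y) (lam : Measure Y) (A : Set Y) : Set (Ω → ℂ) :=
  {e | ∃ v : SimpleFunc Y ℂ, NonposClass lam A v ∧ e = fun ω => Complex.exp (∫ y, v y ∂(η ω))}

/-- The exponent is real and at most 0 for every `ω`; where `v` is not integrable its integral is 0
by convention, so the bound persists. -/
lemma IsPoissonProcess.isTestFamily (h : IsPoissonProcess η lam prob) :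
    IsTestFamily prob (laplaceFamily η lam A) := by
  rintro _ ⟨v, hv, rfl⟩
  refine ⟨(h.exp_integral hv.integrable).1.aestronglyMeasurable, Eventually.of_forall fun ω => ?_⟩
  choose r hr hr' using hv.nonpos
  simp_rw [hr']
  rw [integral_complex_ofReal, ← Complex.ofReal_exp, Complex.norm_real,
    Real.norm_of_nonneg (Real.exp_pos _).le, Real.exp_le_one_iff]
  exact integral_nonpos hr

/-- The negative of the indicator function of `B`, as a simple function. -/
noncomputable def negIndicator (B : Set Y) (hB : MeasurableSet B) : SimpleFunc Y ℂ :=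
  SimpleFunc.piecewise B hB (SimpleFunc.const Y (-1)) 0

lemma negIndicator_apply (hB : MeasurableSet B) (y : Y) :
    negIndicator B hB y = B.indicator (fun _ => (-1 : ℂ)) y := by
  by_cases h : y ∈ B <;> simp [negIndicator, h]

lemma nonposClass_negIndicator (hB : MeasurableSet B) (hBA : B ⊆ A) (hfin : lam B ≠ ∞) :
    NonposClass lam A (negIndicator B hB) := by
  refine ⟨fun y hy => ?_, ?_, fun y => ?_⟩
  · rw [negIndicator_apply, Set.indicator_of_notMem (fun h => hy (hBA h))]
  · have : (negIndicator B hB : Y → ℂ) = B.indicator (fun _ => (-1 : ℂ)) :=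
      funext (negIndicator_apply hB)
    rw [this, integrable_indicator_iff hB]
    exact integrableOn_const hfin
  · rw [negIndicator_apply]
    by_cases h : y ∈ B
    · exact ⟨-1, by norm_num, by simp [h]⟩
    · exact ⟨0, le_rfl, by simp [h]⟩

omit [IsProbabilityMeasure prob] in
-- The function -1_B is almost surely integrable against the process, which fails where η(B) = ∞.
lemma IsPoissonProcess.ae_ne_top (h : IsPoissonProcess η lam prob) (hB : MeasurableSet B)
    (hfin : lam B ≠ ∞) : ∀ᵐ ω ∂prob, ∃ k : ℕ, η ω B = k := by
  filter_upwards [h.ae_integral_eq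
    (nonposClass_negIndicator (A := B) hB subset_rfl hfin).integrable] with ω hω
  refine (h.integerValued ω B hB).resolve_left fun ht => ?_
  have h1 := hω.1
  have : (negIndicator B hB : Y → ℂ) = B.indicator (fun _ => (-1 : ℂ)) :=
    funext (negIndicator_apply hB)
  rw [this, integrable_indicator_iff hB, integrableOn_const_iff (by simp)] at h1
  simp [ht] at h1

omit [IsProbabilityMeasure prob] in
-- Multiplying the Laplace functional of `v` by exp(-η(B)) gives that of v - 1_B.
lemma IsPoissonProcess.isMultiplier_exp_neg (h : IsPoissonProcess η lam prob)
    (hB : MeasurableSet B) (hBA : B ⊆ A) (hfin : lam B ≠ ∞) :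
    IsMultiplier prob (laplaceFamily η lam A)
      (fun ω => ((Real.exp (-(η ω B).toReal) : ℝ) : ℂ)) := by
  have hmeas : Measurable (fun ω => ((Real.exp (-(η ω B).toReal) : ℝ) : ℂ)) := by
    have := h.measurable_apply hB
    fun_prop
  refine IsMultiplier.of_mul_mem hmeas.aestronglyMeasurable (Eventually.of_forall fun ω => ?_) ?_
  · rw [Complex.norm_real, Real.norm_of_nonneg (Real.exp_pos _).le, Real.exp_le_one_iff]
    simp
  · rintro _ ⟨v, hv, rfl⟩
    have hn := nonposClass_negIndicator (lam := lam) hB hBA hfin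
    refine ⟨_, ⟨v + negIndicator B hB, hv.add hn, rfl⟩, ?_⟩
    filter_upwards [h.ae_integral_eq hv.integrable, h.ae_integral_eq hn.integrable] with ω h1 h2
    have h3 : ∫ y, (v + negIndicator B hB) y ∂(η ω) =
        ∫ y, v y ∂(η ω) + ∫ y, negIndicator B hB y ∂(η ω) := integral_add h1.1 h2.1
    have h4 : ∫ y, negIndicator B hB y ∂(η ω) = ((-(η ω B).toReal : ℝ) : ℂ) := by
      simp_rw [negIndicator_apply]
      rw [integral_indicator hB, setIntegral_const]
      simp [Measure.real]
    rw [h3, h4, Complex.exp_add, Complex.ofReal_exp, mul_comm]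

/-- With q = exp(-η(B)) and c = exp(-k), the polynomials (1 - (q - c)²)ⁿ in `q` are multipliers.
Since |q - c| < 1, they stay in [0, 1] and converge to the indicator of {q = c}, which is almost
surely {η(B) = k}. -/
lemma IsPoissonProcess.isMultiplier_eq (h : IsPoissonProcess η lam prob)
    (hB : MeasurableSet B) (hBA : B ⊆ A) (hfin : lam B ≠ ∞) (k : ℕ) :
    IsMultiplier prob (laplaceFamily η lam A) ({ω | η ω B = k}.indicator 1) := by
  let q : Ω → ℝ := fun ω => Real.exp (-(η ω B).toReal)
  let c : ℝ := Real.exp (-k)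
  have hd : ∀ ω, |q ω - c| < 1 := fun ω => by
    have h1 : q ω ≤ 1 := Real.exp_le_one_iff.2 (by simp)
    have h2 : c ≤ 1 := Real.exp_le_one_iff.2 (by simp)
    have h3 : 0 < q ω := Real.exp_pos _
    have h4 : 0 < c := Real.exp_pos _
    rw [abs_lt]
    constructor <;> linarith
  have hb : ∀ ω, 0 < 1 - (q ω - c) ^ 2 := fun ω => by
    have := (sq_lt_one_iff_abs_lt_one _).2 (hd ω)
    linarith
  have hq := h.isMultiplier_exp_neg hB hBA hfin
  have h𝓔 := h.isTestFamily (A := A)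
  have hm : ∀ n : ℕ, IsMultiplier prob (laplaceFamily η lam A)
      (fun ω => (((1 - (q ω - c) ^ 2) ^ n : ℝ) : ℂ)) := by
    intro n
    have := (IsMultiplier.sub h𝓔 (IsMultiplier.const 1)
      ((hq.sub h𝓔 (IsMultiplier.const (c : ℂ))).pow 2)).pow n
    refine this.congr (Eventually.of_forall fun ω => ?_)
    simp only [q]
    push_cast
    rfl
  refine IsMultiplier.of_tendsto h𝓔 hm (fun n => Eventually.of_forall fun ω => ?_) ?_
  · rw [Complex.norm_real, Real.norm_of_nonneg (pow_nonneg (hb ω).le _)]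
    exact pow_le_one₀ (hb ω).le (by nlinarith [sq_nonneg (q ω - c)])
  · filter_upwards [h.ae_ne_top hB hfin] with ω hω
    obtain ⟨j, hj⟩ := hω
    have hqj : q ω = Real.exp (-j) := by simp [q, hj]
    by_cases hjk : j = k
    · have h1 : ω ∈ {ω | η ω B = k} := by rw [Set.mem_ofPred_eq, hj, hjk]
      rw [Set.indicator_of_mem h1]
      have h2 : q ω - c = 0 := by rw [hqj, hjk, sub_self]
      simp [h2]
    · have h1 : ω ∉ {ω | η ω B = k} := by
        rw [Set.mem_ofPred_eq, hj]
        exact_mod_cast hjk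
      rw [Set.indicator_of_notMem h1]
      have h2 : q ω - c ≠ 0 := by
        rw [hqj, sub_ne_zero]
        intro h3
        have := Real.exp_injective h3
        apply hjk
        exact_mod_cast neg_injective this
      have h3 : Tendsto (fun n : ℕ => (1 - (q ω - c) ^ 2) ^ n) atTop (𝓝 0) :=
        tendsto_pow_atTop_nhds_zero_of_lt_one (hb ω).le (by
          have := sq_pos_of_ne_zero h2
          linarith)
      have h4 := (Complex.continuous_ofReal.tendsto 0).comp h3
      rwa [Complex.ofReal_zero] at h4

lemma IsPoissonProcess.sigmaGen_le_multiplierSigma (h : IsPoissonProcess η lam prob) :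
    sigmaGen η A ≤ multiplierSigma (h.isTestFamily (A := A)) := by
  refine iSup_le fun B => iSup_le fun hB => iSup_le fun hBA => ?_
  rintro _ ⟨T, hT, rfl⟩
  -- For infinite intensity η(B) = ∞ almost surely, so the event is trivial. Otherwise it is almost
  -- surely the union of the events {η(B) = k} over the natural numbers `k` in `T`.
  by_cases hfin : lam B = ∞
  · have h1 := h.law_top B hB hfin
    refine (IsMultiplier.const (T.indicator 1 ∞ : ℂ)).congr ?_
    filter_upwards [h1] with ω hω
    by_cases hT : ∞ ∈ T
    · rw [Set.indicator_of_mem hT, Set.indicator_of_mem (by rwa [Set.mem_preimage, hω])]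
      rfl
    · rw [Set.indicator_of_notMem hT, Set.indicator_of_notMem (by rwa [Set.mem_preimage, hω])]
  · obtain ⟨K, hK⟩ : ∃ K : Set Ω, K = ⋃ k ∈ {k : ℕ | (k : ℝ≥0∞) ∈ T}, {ω | η ω B = k} := ⟨_, rfl⟩
    have h1 : MeasurableSet[multiplierSigma (h.isTestFamily (A := A))] K := hK ▸
      MeasurableSet.biUnion (Set.to_countable _) fun k _ => h.isMultiplier_eq hB hBA hfin k
    refine IsMultiplier.congr (x := K.indicator 1) h1 ?_
    filter_upwards [h.ae_ne_top hB hfin] with ω hω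
    obtain ⟨j, hj⟩ := hω
    have h2 : ω ∈ K ↔ ω ∈ (fun ω => η ω B) ⁻¹' T := by
      simp only [hK, Set.mem_iUnion, Set.mem_ofPred_eq, Set.mem_preimage, hj, Nat.cast_inj,
        exists_prop]
      constructor
      · rintro ⟨k, hk, rfl⟩
        exact hk
      · exact fun h => ⟨j, h, rfl⟩
    by_cases h3 : ω ∈ (fun ω => η ω B) ⁻¹' T
    · rw [Set.indicator_of_mem h3, Set.indicator_of_mem (h2.2 h3)]
    · rw [Set.indicator_of_notMem h3, Set.indicator_of_notMem (fun h => h3 (h2.1 h))]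

/-- The vectors `Σ_g`, `g` simple on `A`, are total in the space of square integrable functions of
the restriction of the process to `A`. -/
theorem IsPoissonProcess.eq_zero_of_inner_expRV [prob.IsComplete]
    (h : IsPoissonProcess η lam prob) (hℓ : IsMeasurableLog ℓ) {u : Lp ℂ 2 prob}
    (hu : u ∈ lpMeas ℂ ℂ (sigmaOn η prob A) 2 prob)
    (horth : ∀ (g : SimpleFunc Y ℂ) (hg : SimpleClass lam A g),
      inner ℂ ((h.memLp_expRV hℓ hg).toLp (expRV ℓ η prob g)) u = 0) : u = 0 := by
  have hint : Integrable u prob := (Lp.memLp u).integrable (by norm_num)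
  -- A Laplace functional is real and a nonzero multiple of Σ_{exp v - 1}, so orthogonality to the
  -- exponential vectors becomes annihilation.
  have hann : (u : Ω → ℂ) ∈ annihilator prob (laplaceFamily η lam A) := by
    refine ⟨hint, ?_⟩
    rintro _ ⟨v, hv, rfl⟩
    let g := v.map (fun z => Complex.exp z - 1)
    let c : ℂ := ∫ ω, Complex.exp (∫ y, ℓ (1 + g y) ∂(η ω)) ∂prob
    have hc : c ≠ 0 := by
      simp only [c]
      rw [h.integral_exp_log hℓ hv.simpleClass]
      exact Complex.exp_ne_zero _
    have h1 := horth g hv.simpleClass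
    rw [L2.inner_def] at h1
    have h2 : ∀ᵐ ω ∂prob, inner ℂ ((h.memLp_expRV hℓ hv.simpleClass).toLp
        (expRV ℓ η prob g) ω) (u ω) =
        (starRingEnd ℂ c)⁻¹ * (u ω * Complex.exp (∫ y, v y ∂(η ω))) := by
      filter_upwards [(h.memLp_expRV hℓ hv.simpleClass).coeFn_toLp] with ω hω
      rw [hω, RCLike.inner_apply, expRV, map_div₀]
      have h3 : ∫ y, ℓ (1 + g y) ∂(η ω) = ∫ y, v y ∂(η ω) := by
        simp_rw [g, hv.log_eq hℓ]
      have h4 : starRingEnd ℂ (Complex.exp (∫ y, v y ∂(η ω))) =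
          Complex.exp (∫ y, v y ∂(η ω)) := by
        rw [← Complex.exp_conj, ← integral_conj]
        congr 2
        ext y
        obtain ⟨r, -, hr⟩ := hv.nonpos y
        rw [hr, Complex.conj_ofReal]
      rw [h3, h4]
      simp only [c]
      ring
    rw [integral_congr_ae h2, integral_const_mul] at h1
    exact (mul_eq_zero.1 h1).resolve_left
      (inv_ne_zero ((map_ne_zero (starRingEnd ℂ)).2 hc))
  have hgen : ∀ F, MeasurableSet[sigmaGen η A] F → ∫ ω in F, u ω ∂prob = 0 := by
    intro F hF
    have h1 : IsMultiplier prob (laplaceFamily η lam A) (F.indicator 1) :=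
      h.sigmaGen_le_multiplierSigma F hF
    -- Taking v = 0 gives the test function 1: the annihilated function u · 1_F has integral zero.
    have h2 := (h1.mul_mem u hann).2 _ ⟨0, NonposClass.zero, rfl⟩
    rw [← integral_indicator (h.sigmaGen_le F hF), ← h2]
    refine integral_congr_ae (Eventually.of_forall fun ω => ?_)
    by_cases hω : ω ∈ F <;> simp [hω]
  have hae : (u : Ω → ℂ) =ᵐ[prob] fun _ => 0 := by
    refine ae_eq_of_forall_setIntegral_eq_of_sigmaFinite' (h.sigmaOn_le (A := A) (prob := prob))
      (fun s _ _ => hint.integrableOn) (fun s _ _ => (integrable_zero _ _ _).integrableOn)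
      (fun s hs _ => ?_) (mem_lpMeas_iff_aestronglyMeasurable.1 hu) aestronglyMeasurable_const
    obtain ⟨t, ht, hst⟩ := hs
    rw [setIntegral_congr_set hst, hgen t ht, integral_zero]
  apply Lp.ext
  exact hae.trans (Lp.coeFn_zero ℂ 2 prob).symm

end Totality

/-! ### Independence over disjoint sets and product formulas -/

section Products

variable {Y Ω : Type*} [MeasurableSpace Y] [MeasurableSpace Ω] {lam : Measure Y}
  {A A₁ A₂ S X : Set Y} {η : Ω → Measure Y} {prob : Measure Ω} [IsProbabilityMeasure prob]
  {ℓ : ℂ → ℂ}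

/-- The closed span of the vectors `Σ_g`, `g` simple on `A`. -/
noncomputable def IsPoissonProcess.expSpan (h : IsPoissonProcess η lam prob)
    (hℓ : IsMeasurableLog ℓ) (A : Set Y) : Submodule ℂ (Lp ℂ 2 prob) :=
  (Submodule.span ℂ {x | ∃ (g : SimpleFunc Y ℂ) (hg : SimpleClass lam A g),
    x = (h.memLp_expRV hℓ hg).toLp (expRV ℓ η prob g)}).topologicalClosure

lemma IsPoissonProcess.expSpan_le (h : IsPoissonProcess η lam prob) (hℓ : IsMeasurableLog ℓ)
    {K : Submodule ℂ (Lp ℂ 2 prob)} (hK : IsClosed (K : Set (Lp ℂ 2 prob)))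
    (hs : ∀ (g : SimpleFunc Y ℂ) (hg : SimpleClass lam A g),
      (h.memLp_expRV hℓ hg).toLp (expRV ℓ η prob g) ∈ K) : h.expSpan hℓ A ≤ K := by
  refine Submodule.topologicalClosure_minimal _ (Submodule.span_le.2 ?_) hK
  rintro _ ⟨g, hg, rfl⟩
  exact hs g hg

/-- The component of a measurable vector orthogonal to the span is again measurable, so totality
kills it. Closed linear statements about these spaces may from here on be checked on exponential
vectors. -/
lemma IsPoissonProcess.lpMeas_eq_expSpan [prob.IsComplete] (h : IsPoissonProcess η lam prob)
    (hℓ : IsMeasurableLog ℓ) :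
    lpMeas ℂ ℂ (sigmaOn η prob A) 2 prob = h.expSpan hℓ A := by
  have hle : h.expSpan hℓ A ≤ lpMeas ℂ ℂ (sigmaOn η prob A) 2 prob :=
    h.expSpan_le hℓ h.isClosed_lpMeas fun g hg => h.toLp_expRV_mem hℓ hg
  refine le_antisymm (fun u hu => ?_) hle
  have : CompleteSpace (h.expSpan hℓ A) :=
    (Submodule.isClosed_topologicalClosure _).completeSpace_coe
  obtain ⟨y, hy, z, hz, rfl⟩ := (h.expSpan hℓ A).exists_add_mem_mem_orthogonal u
  have hz' : z ∈ lpMeas ℂ ℂ (sigmaOn η prob A) 2 prob := by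
    have := Submodule.sub_mem _ hu (hle hy)
    rwa [add_sub_cancel_left] at this
  have hz0 : z = 0 := h.eq_zero_of_inner_expRV hℓ hz' fun g hg =>
    (Submodule.mem_orthogonal _ _).1 hz _
      (Submodule.le_topologicalClosure _ (Submodule.subset_span ⟨g, hg, rfl⟩))
  rwa [hz0, add_zero]

/-- Functions of the restrictions of the process to disjoint sets are uncorrelated. -/
lemma IsPoissonProcess.inner_eq_mul [prob.IsComplete] (h : IsPoissonProcess η lam prob)
    (hℓ : IsMeasurableLog ℓ) (hA₁ : MeasurableSet A₁) (hd : Disjoint A₁ A₂) {v w : Lp ℂ 2 prob}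
    (hv : v ∈ lpMeas ℂ ℂ (sigmaOn η prob A₁) 2 prob)
    (hw : w ∈ lpMeas ℂ ℂ (sigmaOn η prob A₂) 2 prob) :
    inner ℂ v w = (∫ ω, starRingEnd ℂ (v ω) ∂prob) * ∫ ω, w ω ∂prob := by
  -- This is Σ_0 = 1, so expectations are inner products with it.
  let e₀ : Lp ℂ 2 prob := (h.memLp_expRV hℓ (SimpleClass.zero (A := Set.univ))).toLp (expRV ℓ η prob 0)
  have he₀ : e₀ =ᵐ[prob] fun _ => 1 := by
    filter_upwards [(h.memLp_expRV hℓ (SimpleClass.zero (A := Set.univ))).coeFn_toLp] with ω hω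
    rw [hω]
    simp [expRV, hℓ.one]
  have hv₀ : ∀ v : Lp ℂ 2 prob, inner ℂ v e₀ = ∫ ω, starRingEnd ℂ (v ω) ∂prob := by
    intro v
    rw [L2.inner_def]
    refine integral_congr_ae ?_
    filter_upwards [he₀] with ω hω
    rw [hω, RCLike.inner_apply, one_mul]
  have hw₀ : ∀ w : Lp ℂ 2 prob, inner ℂ e₀ w = ∫ ω, w ω ∂prob := by
    intro w
    rw [L2.inner_def]
    refine integral_congr_ae ?_
    filter_upwards [he₀] with ω hω
    rw [hω, RCLike.inner_apply, map_one, mul_one]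
  rw [← hv₀, ← hw₀]
  rw [h.lpMeas_eq_expSpan hℓ] at hv hw
  have hee : ∀ (g : SimpleFunc Y ℂ) (hg : SimpleClass lam A₂ g),
      inner ℂ e₀ ((h.memLp_expRV hℓ hg).toLp (expRV ℓ η prob g)) = 1 := by
    intro g hg
    have h1 := h.inner_expRV hℓ (SimpleClass.zero (A := Set.univ))
      (hg.mono (Set.subset_univ _))
    rw [show (SimpleClass.zero (lam := lam) (A := Set.univ)).memLp.toLp (0 : SimpleFunc Y ℂ) = 0
      from MemLp.toLp_zero _, inner_zero_left, Complex.exp_zero] at h1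
    exact h1
  -- For `k` on `A₁` and `g` on `A₂` both ⟪Σ_k, Σ_g⟫ and ⟪Σ_k, Σ_0⟫ are exp 0. Seen from the
  -- functionals of the process on `A₁`, `Σ_g` is thus indistinguishable from 1.
  have h12 : ∀ (g : SimpleFunc Y ℂ) (hg : SimpleClass lam A₂ g),
      inner ℂ v ((h.memLp_expRV hℓ hg).toLp (expRV ℓ η prob g)) = inner ℂ v e₀ := by
    intro g hg
    let x := (h.memLp_expRV hℓ hg).toLp (expRV ℓ η prob g) - e₀
    have h1 : h.expSpan hℓ A₁ ≤ (Submodule.span ℂ {x})ᗮ := by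
      refine h.expSpan_le hℓ (Submodule.isClosed_orthogonal _) fun k hk => ?_
      rw [Submodule.mem_orthogonal_singleton_iff_inner_left, inner_sub_right, sub_eq_zero]
      have h2 := h.inner_expRV hℓ (hk.mono (Set.subset_univ _)) (hg.mono (Set.subset_univ _))
      have h3 := h.inner_expRV hℓ (hk.mono (Set.subset_univ _))
        (SimpleClass.zero (A := Set.univ))
      rw [inner_eq_zero_of_disjoint hA₁ hk.toLp_mem hg.toLp_mem hd] at h2
      rw [show (SimpleClass.zero (lam := lam) (A := Set.univ)).memLp.toLp (0 : SimpleFunc Y ℂ) = 0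
        from MemLp.toLp_zero _, inner_zero_right] at h3
      exact h2.trans h3.symm
    have h2 := (Submodule.mem_orthogonal_singleton_iff_inner_left).1 (h1 hv)
    rwa [inner_sub_right, sub_eq_zero] at h2
  let x := v - (starRingEnd ℂ (inner ℂ v e₀)) • e₀
  have h1 : h.expSpan hℓ A₂ ≤ (Submodule.span ℂ {x})ᗮ := by
    refine h.expSpan_le hℓ (Submodule.isClosed_orthogonal _) fun g hg => ?_
    rw [Submodule.mem_orthogonal_singleton_iff_inner_right, inner_sub_left, inner_smul_left,
      Complex.conj_conj, hee g hg, mul_one, h12 g hg, sub_self]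
  have h2 := (Submodule.mem_orthogonal_singleton_iff_inner_right).1 (h1 hw)
  rwa [inner_sub_left, inner_smul_left, Complex.conj_conj, sub_eq_zero] at h2

/-- For indicator functions, being uncorrelated is independence. The exponential kernel thus yields
independence of the whole completed σ-algebras. -/
lemma IsPoissonProcess.indep_sigmaOn [prob.IsComplete] (h : IsPoissonProcess η lam prob)
    (hℓ : IsMeasurableLog ℓ) (hA₁ : MeasurableSet A₁) (hd : Disjoint A₁ A₂) :
    Indep (sigmaOn η prob A₁) (sigmaOn η prob A₂) prob := by
  rw [Indep_iff]
  intro s t hs ht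
  have hs' := h.sigmaOn_le s hs
  have ht' := h.sigmaOn_le t ht
  have h1 := h.inner_eq_mul hℓ hA₁ hd
    (mem_lpMeas_indicatorConstLp h.sigmaOn_le hs (measure_ne_top _ _) (c := (1 : ℂ)))
    (mem_lpMeas_indicatorConstLp h.sigmaOn_le ht (measure_ne_top _ _) (c := (1 : ℂ)))
  have h2 : ∀ {s : Set Ω} (hs : MeasurableSet s),
      ∫ ω, indicatorConstLp 2 hs (measure_ne_top prob s) (1 : ℂ) ω ∂prob = prob.real s := by
    intro s hs
    rw [integral_congr_ae indicatorConstLp_coeFn, integral_indicator_const _ hs]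
    simp
  rw [L2.inner_indicatorConstLp_eq_setIntegral_inner, setIntegral_congr_ae (g := fun ω =>
    t.indicator (fun _ => (1 : ℂ)) ω) hs' (by
      filter_upwards [indicatorConstLp_coeFn (p := 2) (hs := ht')
        (hμs := measure_ne_top prob t) (c := (1 : ℂ))] with ω hω _
      rw [hω, RCLike.inner_apply, map_one, mul_one]),
    setIntegral_indicator ht', integral_conj, h2, h2, setIntegral_const] at h1
  simp only [Complex.real_smul, mul_one, Complex.conj_ofReal] at h1
  have h3 : prob.real (s ∩ t) = prob.real s * prob.real t := by exact_mod_cast h1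
  rw [← ENNReal.toReal_eq_toReal_iff' (measure_ne_top _ _)
    (ENNReal.mul_ne_top (measure_ne_top _ _) (measure_ne_top _ _)), ENNReal.toReal_mul]
  exact h3

lemma IsPoissonProcess.indepFun_of_disjoint [prob.IsComplete] (h : IsPoissonProcess η lam prob)
    (hℓ : IsMeasurableLog ℓ) (hA₁ : MeasurableSet A₁) (hd : Disjoint A₁ A₂) {x y : Ω → ℂ}
    (hx : AEStronglyMeasurable[sigmaOn η prob A₁] x prob)
    (hy : AEStronglyMeasurable[sigmaOn η prob A₂] y prob) : IndepFun x y prob := by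
  obtain ⟨x', hx', hxx⟩ := hx
  obtain ⟨y', hy', hyy⟩ := hy
  refine IndepFun.congr ?_ hxx.symm hyy.symm
  rw [IndepFun_iff_Indep]
  exact indep_of_indep_of_le_left (indep_of_indep_of_le_right (h.indep_sigmaOn hℓ hA₁ hd)
    hy'.measurable.comap_le) hx'.measurable.comap_le

omit [IsProbabilityMeasure prob] in
lemma memLp_two_mul_of_indepFun {x y : Ω → ℂ} (hxy : IndepFun x y prob) (hx : MemLp x 2 prob)
    (hy : MemLp y 2 prob) : MemLp (fun ω => x ω * y ω) 2 prob := by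
  refine (memLp_two_iff_integrable_sq_norm (hx.1.mul hy.1)).2 ?_
  have h1 := (memLp_two_iff_integrable_sq_norm hx.1).1 hx
  have h2 := (memLp_two_iff_integrable_sq_norm hy.1).1 hy
  have hm : Measurable (fun z : ℂ => ‖z‖ ^ 2) := by fun_prop
  have h3 := (hxy.comp hm hm).integrable_mul h1 h2
  refine h3.congr (Eventually.of_forall fun ω => ?_)
  simp [mul_pow]

/-- Because ℓ 1 = 0, the function ℓ(1 + f) is the sum of its analogues for the two restrictions; the
exponentials and their normalisations multiply accordingly. -/
lemma IsPoissonProcess.expRV_eq_mul (h : IsPoissonProcess η lam prob) (hℓ : IsMeasurableLog ℓ)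
    {f : SimpleFunc Y ℂ} (hf : SimpleClass lam A f) (hS : MeasurableSet S) :
    expRV ℓ η prob f =ᵐ[prob]
      fun ω => expRV ℓ η prob (f.restrict S) ω * expRV ℓ η prob (f.restrict Sᶜ) ω := by
  have h1 := hf.restrict hS
  have h2 := hf.restrict hS.compl
  have hadd : ∀ y, f y = f.restrict S y + f.restrict Sᶜ y := fun y => by
    rw [SimpleFunc.coe_restrict f hS, SimpleFunc.coe_restrict f hS.compl]
    by_cases hy : y ∈ S <;> simp [hy]
  have hlog : ∀ y, ℓ (1 + f y) = ℓ (1 + f.restrict S y) + ℓ (1 + f.restrict Sᶜ y) := fun y => by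
    rw [SimpleFunc.coe_restrict f hS, SimpleFunc.coe_restrict f hS.compl]
    by_cases hy : y ∈ S <;> simp [hy, hℓ.one]
  filter_upwards [h.ae_integral_eq (h1.integrable_log hℓ), h.ae_integral_eq (h2.integrable_log hℓ)]
    with ω e1 e2
  have e3 : ∫ y, ℓ (1 + f y) ∂(η ω) =
      ∫ y, ℓ (1 + f.restrict S y) ∂(η ω) + ∫ y, ℓ (1 + f.restrict Sᶜ y) ∂(η ω) := by
    simp_rw [hlog]
    exact integral_add e1.1 e2.1
  have e4 : ∫ y, f y ∂lam = ∫ y, f.restrict S y ∂lam + ∫ y, f.restrict Sᶜ y ∂lam := by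
    simp_rw [hadd]
    exact integral_add h1.integrable h2.integrable
  rw [expRV, expRV, expRV, h.integral_exp_log hℓ hf, h.integral_exp_log hℓ h1,
    h.integral_exp_log hℓ h2, e3, e4, Complex.exp_add, Complex.exp_add, div_mul_div_comm]

/-- Correlations with `Σ_f` factorize. -/
lemma IsPoissonProcess.inner_expVector_of_mul [prob.IsComplete] (h : IsPoissonProcess η lam prob)
    (hℓ : IsMeasurableLog ℓ) (hX : MeasurableSet X) (hA : MeasurableSet A) (hAX : A ⊆ X)
    (hS : MeasurableSet S) {v w z : Lp ℂ 2 prob}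
    (hv : v ∈ lpMeas ℂ ℂ (sigmaOn η prob (A ∩ S)) 2 prob)
    (hw : w ∈ lpMeas ℂ ℂ (sigmaOn η prob (A ∩ Sᶜ)) 2 prob)
    (hz : z =ᵐ[prob] fun ω => v ω * w ω) {f : Lp ℂ 2 lam} (hf : f ∈ L2On lam A) :
    inner ℂ (h.expVector hℓ X f) z = inner ℂ (h.expVector hℓ X (restrictL2 lam hS f)) v *
      inner ℂ (h.expVector hℓ X (restrictL2 lam hS.compl f)) w := by
  have hcont : ∀ {T : Set Y} (hT : MeasurableSet T),
      Continuous (fun f : L2On lam A => h.expVector hℓ X (restrictL2 lam hT f)) := fun {T} hT =>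
    (h.continuous_expVector hℓ hX).comp (f := fun f : L2On lam A =>
      (⟨restrictL2 lam hT f, L2On_mono (inter_subset_left.trans hAX) (restrictL2_mem hT f.2)⟩ :
        L2On lam X)) (by fun_prop)
  refine L2On_induction hA (p := fun f => inner ℂ (h.expVector hℓ X f) z =
    inner ℂ (h.expVector hℓ X (restrictL2 lam hS f)) v *
      inner ℂ (h.expVector hℓ X (restrictL2 lam hS.compl f)) w) ?_ (fun g hg => ?_) hf
  · refine isClosed_eq ((h.continuous_expVector_of_subset hℓ hX hAX).inner continuous_const) ?_
    exact ((hcont hS).inner continuous_const).mul ((hcont hS.compl).inner continuous_const)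
  · have g1 := hg.restrict hS
    have g2 := hg.restrict hS.compl
    rw [← hg.toLp_restrict hS, ← hg.toLp_restrict hS.compl, h.expVector_toLp hℓ hX (hg.mono hAX),
      h.expVector_toLp hℓ hX (g1.mono (inter_subset_left.trans hAX)),
      h.expVector_toLp hℓ hX (g2.mono (inter_subset_left.trans hAX))]
    set x₁ := (h.memLp_expRV hℓ g1).toLp (expRV ℓ η prob (g.restrict S))
    set x₂ := (h.memLp_expRV hℓ g2).toLp (expRV ℓ η prob (g.restrict Sᶜ))
    have m1 := mem_lpMeas_iff_aestronglyMeasurable.1 (h.toLp_expRV_mem hℓ g1)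
    have m2 := mem_lpMeas_iff_aestronglyMeasurable.1 (h.toLp_expRV_mem hℓ g2)
    have hconj : Continuous (starRingEnd ℂ) := Complex.continuous_conj
    have k1 : AEStronglyMeasurable[sigmaOn η prob (A ∩ S)]
        (fun ω => v ω * starRingEnd ℂ (x₁ ω)) prob :=
      (mem_lpMeas_iff_aestronglyMeasurable.1 hv).mul (hconj.comp_aestronglyMeasurable m1)
    have k2 : AEStronglyMeasurable[sigmaOn η prob (A ∩ Sᶜ)]
        (fun ω => w ω * starRingEnd ℂ (x₂ ω)) prob :=
      (mem_lpMeas_iff_aestronglyMeasurable.1 hw).mul (hconj.comp_aestronglyMeasurable m2)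
    -- The conjugate of `Σ_g` times v w regroups into two factors living on A ∩ S and A ∩ Sᶜ, so the
    -- expectation is a product.
    have hind := h.indepFun_of_disjoint hℓ (hA.inter hS)
      (disjoint_compl_right.mono inter_subset_right inter_subset_right) k1 k2
    rw [L2.inner_def, L2.inner_def, L2.inner_def]
    simp only [RCLike.inner_apply]
    rw [← hind.integral_fun_mul_eq_mul_integral (k1.mono h.sigmaOn_le) (k2.mono h.sigmaOn_le)]
    refine integral_congr_ae ?_
    filter_upwards [hz, (h.memLp_expRV hℓ hg).coeFn_toLp, (h.memLp_expRV hℓ g1).coeFn_toLp,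
      (h.memLp_expRV hℓ g2).coeFn_toLp, h.expRV_eq_mul hℓ hg hS] with ω e1 e2 e3 e4 e5
    have e2' : (h.memLp_expRV hℓ (hg.mono hAX)).toLp (expRV ℓ η prob g) ω = expRV ℓ η prob g ω := e2
    rw [e1, e2', e3, e4, e5, map_mul]
    ring

/-- `Σ_f` is the product of the exponential vectors of the restrictions of `f`. -/
lemma IsPoissonProcess.expVector_eq_mul [prob.IsComplete] (h : IsPoissonProcess η lam prob)
    (hℓ : IsMeasurableLog ℓ) (hX : MeasurableSet X) (hA : MeasurableSet A) (hAX : A ⊆ X)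
    (hS : MeasurableSet S) {f : Lp ℂ 2 lam} (hf : f ∈ L2On lam A) :
    h.expVector hℓ X f =ᵐ[prob] fun ω => h.expVector hℓ X (restrictL2 lam hS f) ω *
      h.expVector hℓ X (restrictL2 lam hS.compl f) ω := by
  have m1 := h.expVector_mem hℓ hX (hA.inter hS) (inter_subset_left.trans hAX)
    (restrictL2_mem hS hf)
  have m2 := h.expVector_mem hℓ hX (hA.inter hS.compl) (inter_subset_left.trans hAX)
    (restrictL2_mem hS.compl hf)
  have hm : ∀ {T : Set Y} (hT : MeasurableSet T) {f : Lp ℂ 2 lam}, f ∈ L2On lam A →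
      restrictL2 lam hT f ∈ L2On lam X := fun hT f hf =>
    L2On_mono (inter_subset_left.trans hAX) (restrictL2_mem hT hf)
  set v := h.expVector hℓ X (restrictL2 lam hS f) with hv
  set w := h.expVector hℓ X (restrictL2 lam hS.compl f) with hw
  have k1 := mem_lpMeas_iff_aestronglyMeasurable.1 m1
  have k2 := mem_lpMeas_iff_aestronglyMeasurable.1 m2
  have hind := h.indepFun_of_disjoint hℓ (hA.inter hS)
    (disjoint_compl_right.mono inter_subset_right inter_subset_right) k1 k2
  have hL := memLp_two_mul_of_indepFun hind (Lp.memLp v) (Lp.memLp w)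
  have hz := hL.coeFn_toLp
  set z := hL.toLp _ with hzdef
  have mz : z ∈ lpMeas ℂ ℂ (sigmaOn η prob A) 2 prob := by
    rw [mem_lpMeas_iff_aestronglyMeasurable]
    obtain ⟨v', hv', hvv⟩ := k1
    obtain ⟨w', hw', hww⟩ := k2
    refine ⟨fun ω => v' ω * w' ω, (hv'.mono (sigmaOn_mono inter_subset_left)).mul
      (hw'.mono (sigmaOn_mono inter_subset_left)), ?_⟩
    filter_upwards [hz, hvv, hww] with ω e1 e2 e3
    rw [e1, e2, e3]
  -- Both vectors live on `A` and have the same inner product with every `Σ_g`, since ⟪g, f⟫ is the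
  -- sum of its parts over `S` and `Sᶜ`. Totality then identifies them.
  have hzero : z - h.expVector hℓ X f = 0 := by
    refine h.eq_zero_of_inner_expRV hℓ (Submodule.sub_mem _ mz (h.expVector_mem hℓ hX hA hAX hf))
      fun g hg => ?_
    have e0 := h.expVector_toLp hℓ hX (hg.mono hAX)
    have hgA := hg.toLp_mem
    rw [← e0, inner_sub_right, sub_eq_zero,
      h.inner_expVector hℓ hX (L2On_mono hAX hgA) (L2On_mono hAX hf),
      h.inner_expVector_of_mul hℓ hX hA hAX hS m1 m2 hz hgA, hv, hw,
      h.inner_expVector hℓ hX (hm hS hgA) (hm hS hf),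
      h.inner_expVector hℓ hX (hm hS.compl hgA) (hm hS.compl hf), ← Complex.exp_add]
    congr 1
    rw [inner_restrictL2, inner_restrictL2, restrictL2_restrictL2, restrictL2_restrictL2,
      ← inner_add_right]
    have e1 : restrictL2 lam (hS.inter hS) f = restrictL2 lam hS f := by
      congr 2
      exact inter_self S
    have e2 : restrictL2 lam (hS.compl.inter hS.compl) f = restrictL2 lam hS.compl f := by
      congr 2
      exact inter_self Sᶜ
    rw [e1, e2, restrictL2_add_compl hS f]
  rw [sub_eq_zero] at hzero
  rw [← hzero]
  exact hz

end Products

/-! ### The shift on exponential vectors and between fibres -/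

section ShiftOfVectors

variable {V Y Ω : Type*} [AddGroup V] [MeasurableSpace V] [MeasurableSpace Y] [AddAction V Y]
  [MeasurableVAdd V Y] [MeasurableSpace Ω] {η : Ω → Measure Y} {lam : Measure Y}
  {prob : Measure Ω} [IsProbabilityMeasure prob] [VAddInvariantMeasure V Y lam] {ℓ : ℂ → ℂ}
  {A : Set Y}

/-- The simple function `y ↦ f (y - c)`. -/
noncomputable def translateSimple (c : V) (f : SimpleFunc Y ℂ) : SimpleFunc Y ℂ :=
  f.comp (fun y => -c +ᵥ y) (measurable_const_vadd _)

lemma SimpleClass.translate (c : V) {f : SimpleFunc Y ℂ} (hf : SimpleClass lam A f) :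
    SimpleClass lam (c +ᵥ A) (translateSimple c f) := by
  refine ⟨fun y hy => hf.eq_zero _ fun h => hy (Set.mem_vadd_set_iff_neg_vadd_mem.2 h), ?_,
    fun y hy => hf.ne_neg_one _ (Set.mem_vadd_set_iff_neg_vadd_mem.1 hy)⟩
  exact hf.memLp.comp_measurePreserving (measurePreserving_vadd (-c) lam)

/-- Every `Σ_f` is a functional of the process, and the same functional of the translated process
is `Σ` of the translate of `f`. -/
lemma IsPoissonProcess.exists_functional_expRV (h : IsPoissonProcess η lam prob)
    (hℓ : IsMeasurableLog ℓ) (c : V) {f : SimpleFunc Y ℂ} (hf : SimpleClass lam A f) :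
    ∃ Φ : Lp ℂ 2 (prob.map η),
      Lp.compMeasurePreserving η h.measurePreserving Φ =
        (h.memLp_expRV hℓ hf).toLp (expRV ℓ η prob f) ∧
      Lp.compMeasurePreserving _ (h.measurePreserving_translate c) Φ =
        (h.memLp_expRV hℓ (hf.translate c)).toLp (expRV ℓ η prob (translateSimple c f)) := by
  let v := f.map (fun z => ℓ (1 + z))
  -- The normalisation enters through its deterministic value exp ∫ f, which invariance of `lam`
  -- makes equal for `f` and its translate.
  let φ : Measure Y → ℂ := fun m =>
    Complex.exp (∑ z : v.range, ((m (v ⁻¹' {z.1})).toReal : ℂ) * z.1) /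
      Complex.exp (∫ y, f y ∂lam)
  have hφ : Measurable φ := by
    refine Measurable.div_const (Complex.measurable_exp.comp ?_) _
    refine Finset.measurable_sum _ fun z _ => Measurable.mul_const ?_ _
    exact Complex.measurable_ofReal.comp (ENNReal.measurable_toReal.comp
      (Measure.measurable_coe (v.measurableSet_fiber _)))
  have e1 : φ ∘ η =ᵐ[prob] expRV ℓ η prob f := by
    filter_upwards [h.ae_integral_eq (hf.integrable_log hℓ)] with ω hω
    rw [expRV, h.integral_exp_log hℓ hf]
    simp only [φ, Function.comp_apply]
    congr 2
    exact hω.2.symm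
  have e2 : φ ∘ (fun ω => PoissonProductSystem.translate c (η ω)) =ᵐ[prob]
      expRV ℓ η prob (translateSimple c f) := by
    filter_upwards [(h.isPoissonProcess_translate c).ae_integral_eq (hf.integrable_log hℓ)]
      with ω hω
    rw [expRV, h.integral_exp_log hℓ (hf.translate c)]
    simp only [φ, Function.comp_apply]
    have e3 : ∫ y, translateSimple c f y ∂lam = ∫ y, f y ∂lam :=
      integral_vadd_eq_self (μ := lam) (g := -c) (fun y => f y)
    rw [e3]
    congr 2
    refine hω.2.symm.trans ?_
    rw [PoissonProductSystem.translate, integral_map (measurable_const_vadd _).aemeasurable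
      (SimpleFunc.aestronglyMeasurable _)]
    rfl
  have hL : MemLp φ 2 (prob.map η) := by
    rw [memLp_map_measure_iff hφ.aestronglyMeasurable h.measurable.aemeasurable]
    exact (memLp_congr_ae e1).2 (h.memLp_expRV hℓ hf)
  refine ⟨hL.toLp φ, ?_, ?_⟩
  · rw [Lp.toLp_compMeasurePreserving hL h.measurePreserving]
    exact MemLp.toLp_congr _ _ e1
  · rw [Lp.toLp_compMeasurePreserving hL (h.measurePreserving_translate c)]
    exact MemLp.toLp_congr _ _ e2

lemma IsPoissonProcess.shift_compMeasurePreserving (h : IsPoissonProcess η lam prob) (c : V)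
    (Φ : Lp ℂ 2 (prob.map η)) :
    h.shift c (Lp.compMeasurePreserving η h.measurePreserving Φ) =
      Lp.compMeasurePreserving _ (h.measurePreserving_translate c) Φ :=
  (Lp.isometry_compMeasurePreserving (p := 2) (E := ℂ)
    h.measurePreserving).injective.extend_apply _ _ _

/-- The vectors Φ(η) whose translated version lies in the target form a closed subspace, being the
image of a closed subspace under an isometry. It contains the exponential vectors, hence everything.
-/
lemma IsPoissonProcess.shift_mem [prob.IsComplete] (h : IsPoissonProcess η lam prob)
    (hℓ : IsMeasurableLog ℓ) (c : V) {w : Lp ℂ 2 prob}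
    (hw : w ∈ lpMeas ℂ ℂ (sigmaOn η prob A) 2 prob) :
    h.shift c w ∈ lpMeas ℂ ℂ (sigmaOn η prob (c +ᵥ A)) 2 prob := by
  let J := Lp.compMeasurePreservingₗᵢ (p := 2) (E := ℂ) ℂ η h.measurePreserving
  let T := Lp.compMeasurePreservingₗᵢ (p := 2) (E := ℂ) ℂ _ (h.measurePreserving_translate c)
  let Z := lpMeas ℂ ℂ (sigmaOn η prob (c +ᵥ A)) 2 prob
  have hZ : IsClosed (Z : Set (Lp ℂ 2 prob)) := h.isClosed_lpMeas
  have hcl : IsClosed (((Z.comap T.toLinearMap).map J.toLinearMap : Submodule ℂ (Lp ℂ 2 prob)) :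
      Set (Lp ℂ 2 prob)) :=
    J.isometry.isClosedEmbedding.isClosedMap _ (hZ.preimage T.continuous)
  rw [h.lpMeas_eq_expSpan hℓ] at hw
  obtain ⟨Φ, hΦ, rfl⟩ := h.expSpan_le hℓ hcl (fun g hg => by
    obtain ⟨Φ, h1, h2⟩ := h.exists_functional_expRV hℓ c hg
    refine ⟨Φ, ?_, h1⟩
    change Lp.compMeasurePreserving _ (h.measurePreserving_translate c) Φ ∈ Z
    rw [h2]
    exact h.toLp_expRV_mem hℓ (hg.translate c)) hw
  have h3 := h.shift_compMeasurePreserving c Φ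
  change h.shift c (Lp.compMeasurePreserving η h.measurePreserving Φ) ∈ Z
  rw [h3]
  exact hΦ

/-- The same argument with the two isometries exchanged: `Σ_g` on the translated set comes from the
translate of `g` by -c. -/
lemma IsPoissonProcess.exists_shift_eq [prob.IsComplete] (h : IsPoissonProcess η lam prob)
    (hℓ : IsMeasurableLog ℓ) (c : V) {x : Lp ℂ 2 prob}
    (hx : x ∈ lpMeas ℂ ℂ (sigmaOn η prob (c +ᵥ A)) 2 prob) :
    ∃ w ∈ lpMeas ℂ ℂ (sigmaOn η prob A) 2 prob, h.shift c w = x := by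
  let J := Lp.compMeasurePreservingₗᵢ (p := 2) (E := ℂ) ℂ η h.measurePreserving
  let T := Lp.compMeasurePreservingₗᵢ (p := 2) (E := ℂ) ℂ _ (h.measurePreserving_translate c)
  let Z := lpMeas ℂ ℂ (sigmaOn η prob A) 2 prob
  have hZ : IsClosed (Z : Set (Lp ℂ 2 prob)) := h.isClosed_lpMeas
  have hcl : IsClosed (((Z.comap J.toLinearMap).map T.toLinearMap : Submodule ℂ (Lp ℂ 2 prob)) :
      Set (Lp ℂ 2 prob)) :=
    T.isometry.isClosedEmbedding.isClosedMap _ (hZ.preimage J.continuous)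
  rw [h.lpMeas_eq_expSpan hℓ] at hx
  obtain ⟨Φ, hΦ, rfl⟩ := h.expSpan_le hℓ hcl (fun g hg => by
    have hg' : SimpleClass lam A (translateSimple (-c) g) := by
      simpa using hg.translate (-c)
    have hgg : translateSimple c (translateSimple (-c) g) = g := by
      ext y
      simp [translateSimple]
    obtain ⟨Φ, h1, h2⟩ := h.exists_functional_expRV hℓ c hg'
    refine ⟨Φ, ?_, ?_⟩
    · change Lp.compMeasurePreserving η h.measurePreserving Φ ∈ Z
      rw [h1]
      exact h.toLp_expRV_mem hℓ hg'
    · change Lp.compMeasurePreserving _ (h.measurePreserving_translate c) Φ = _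
      rw [h2]
      simp_rw [hgg]) hx
  exact ⟨J Φ, hΦ, h.shift_compMeasurePreserving c Φ⟩

end ShiftOfVectors

/-! ### Continuity of the flow of sets t ↦ X + t a -/

section Continuity

variable {V Y : Type*} [AddCommGroup V] [Module ℝ V] [MeasurableSpace V] [MeasurableSpace Y]
  [AddAction V Y] [MeasurableVAdd V Y] {lam : Measure Y} [VAddInvariantMeasure V Y lam]
  {S T X : Set Y}

lemma norm_restrictL2_sq (hS : MeasurableSet S) (g : Lp ℂ 2 lam) :
    ‖restrictL2 lam hS g‖ ^ 2 = ∫ y in S, ‖g y‖ ^ 2 ∂lam := by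
  have h1 : inner ℂ (restrictL2 lam hS g) (restrictL2 lam hS g) =
      ((∫ y in S, ‖g y‖ ^ 2 ∂lam : ℝ) : ℂ) := by
    rw [L2.inner_def, ← integral_complex_ofReal, ← integral_indicator hS]
    refine integral_congr_ae ?_
    filter_upwards [coeFn_restrictL2 hS g] with y hy
    rw [hy, inner_self_eq_norm_sq_to_K]
    by_cases h : y ∈ S <;> simp [h]
  rw [inner_self_eq_norm_sq_to_K] at h1
  exact Complex.ofReal_injective (by push_cast; exact h1)

lemma restrictL2_compl_sub (hS : MeasurableSet S) (hT : MeasurableSet T) (hTS : T ⊆ S)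
    (g : Lp ℂ 2 lam) :
    restrictL2 lam hT.compl g - restrictL2 lam hS.compl g = restrictL2 lam (hS.diff hT) g := by
  apply Lp.ext
  filter_upwards [coeFn_restrictL2 hT.compl g, coeFn_restrictL2 hS.compl g,
    coeFn_restrictL2 (hS.diff hT) g,
    Lp.coeFn_sub (restrictL2 lam hT.compl g) (restrictL2 lam hS.compl g)] with y h1 h2 h3 h4
  rw [h4, Pi.sub_apply, h1, h2, h3]
  by_cases h5 : y ∈ T
  · simp [h5, hTS h5]
  · by_cases h6 : y ∈ S <;> simp [h5, h6]

/-- The jump at time `t` of the flow of sets `t ↦ X + t a`. -/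
def flowJump (X : Set Y) (a : V) (t : ℝ) : Set Y :=
  ⋂ n : ℕ, ((t - 1 / ((n : ℝ) + 1)) • a +ᵥ X) \ ((t + 1 / ((n : ℝ) + 1)) • a +ᵥ X)

/-- The jump at `t` is the translate by t a of the jump at 0, so all jumps have the same measure,
and they are pairwise disjoint. In a σ-finite space only countably many disjoint sets have positive
measure, whereas there is one jump for each real `t`. -/
lemma measure_flowJump [SigmaFinite lam] (hX : MeasurableSet X) {a : V}
    (hanti : Antitone fun t : ℝ => t • a +ᵥ X) (t : ℝ) : lam (flowJump X a t) = 0 := by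
  have htr : ∀ t, flowJump X a t = t • a +ᵥ flowJump X a 0 := by
    intro t
    ext y
    simp only [flowJump, Set.mem_iInter, Set.mem_sdiff, Set.mem_vadd_set_iff_neg_vadd_mem,
      vadd_vadd]
    refine forall_congr' fun n => ?_
    have e1 : -((t - 1 / ((n : ℝ) + 1)) • a) = -((0 - 1 / ((n : ℝ) + 1)) • a) + -(t • a) := by
      module
    have e2 : -((t + 1 / ((n : ℝ) + 1)) • a) = -((0 + 1 / ((n : ℝ) + 1)) • a) + -(t • a) := by
      module
    rw [e1, e2]
  have hm : ∀ t, MeasurableSet (flowJump X a t) := fun t =>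
    MeasurableSet.iInter fun n => (hX.const_vadd _).diff (hX.const_vadd _)
  have hlt : ∀ s t, s < t → Disjoint (flowJump X a s) (flowJump X a t) := by
    intro s t hst
    rw [Set.disjoint_left]
    intro y hs ht
    obtain ⟨n, hn⟩ := exists_nat_one_div_lt (half_pos (sub_pos.2 hst))
    refine (Set.mem_iInter.1 hs n).2 (hanti ?_ (Set.mem_iInter.1 ht n).1)
    linarith
  have hd : Pairwise (Function.onFun Disjoint (flowJump X a)) := by
    intro s t hst
    rcases hst.lt_or_gt with h | h
    · exact hlt s t h
    · exact (hlt t s h).symm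
  have hc := Measure.countable_meas_pos_of_disjoint_iUnion (μ := lam) hm hd
  rw [htr, measure_vadd]
  by_contra h0
  have : {t | 0 < lam (flowJump X a t)} = Set.univ := by
    ext t
    simp only [Set.mem_ofPred_eq, Set.mem_univ, iff_true]
    rw [htr, measure_vadd]
    exact pos_iff_ne_zero.2 h0
  rw [this] at hc
  exact Set.not_countable_univ hc

/-- An `L²` function has arbitrarily small pieces along the flow of sets `t ↦ X + t a`. -/
lemma exists_partition_restrictL2_le [SigmaFinite lam] (hX : MeasurableSet X) {a : V}
    (hanti : Antitone fun t : ℝ => t • a +ᵥ X) (g : Lp ℂ 2 lam) {ε : ℝ} (hε : 0 < ε) :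
    ∃ n : ℕ, 0 < n ∧ ∀ k < n, ‖restrictL2 lam
      (hX.const_vadd ((((k + 1 : ℕ) : ℝ) / n) • a)).compl g -
        restrictL2 lam (hX.const_vadd (((k : ℝ) / n) • a)).compl g‖ ≤ ε := by
  have hU : ∀ t : ℝ, MeasurableSet (t • a +ᵥ X) := fun t => hX.const_vadd _
  have hint : Integrable (fun y => ‖g y‖ ^ 2) lam :=
    (memLp_two_iff_integrable_sq_norm (Lp.memLp g).1).1 (Lp.memLp g)
  -- The mass of |g|² still ahead at time `t`. It is continuous because jumps are null, hence
  -- uniformly continuous on [0, 1], and the squared norm of a piece of `g` is an increment of `m`.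
  let m : ℝ → ℝ := fun t => ∫ y in t • a +ᵥ X, ‖g y‖ ^ 2 ∂lam
  have hm : ∀ s t, s ≤ t → m s - m t = ∫ y in (s • a +ᵥ X) \ (t • a +ᵥ X), ‖g y‖ ^ 2 ∂lam :=
    fun s t hst => (setIntegral_sdiff (hU t) hint.integrableOn (hanti hst)).symm
  have hmanti : Antitone m := fun s t hst => by
    have := hm s t hst
    have h1 : 0 ≤ m s - m t := this ▸ setIntegral_nonneg ((hU s).diff (hU t))
      fun y _ => sq_nonneg _
    linarith
  have hcont : Continuous m := by
    rw [Metric.continuous_iff]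
    intro t δ hδ
    have h1 : Tendsto (fun n : ℕ => ∫ y in ((t - 1 / ((n : ℝ) + 1)) • a +ᵥ X) \
        ((t + 1 / ((n : ℝ) + 1)) • a +ᵥ X), ‖g y‖ ^ 2 ∂lam) atTop (𝓝 0) := by
      have := tendsto_setIntegral_of_antitone (μ := lam) (f := fun y => ‖g y‖ ^ 2)
        (s := fun n : ℕ => ((t - 1 / ((n : ℝ) + 1)) • a +ᵥ X) \
        ((t + 1 / ((n : ℝ) + 1)) • a +ᵥ X)) (fun n => (hU _).diff (hU _)) (fun i j hij => by
          have h2 : 1 / ((j : ℝ) + 1) ≤ 1 / ((i : ℝ) + 1) := Nat.one_div_le_one_div hij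
          exact Set.sdiff_subset_sdiff (hanti (by linarith)) (hanti (by linarith)))
        ⟨0, hint.integrableOn⟩
      have h0 : ∫ y in flowJump X a t, ‖g y‖ ^ 2 ∂lam = 0 :=
        setIntegral_measure_zero _ (measure_flowJump hX hanti t)
      rwa [← h0]
    obtain ⟨n, hn⟩ := (h1.eventually_lt_const hδ).exists
    have hpos : 0 < 1 / ((n : ℝ) + 1) := Nat.one_div_pos_of_nat
    rw [← hm _ _ (by linarith)] at hn
    refine ⟨1 / ((n : ℝ) + 1), hpos, fun s hs => ?_⟩
    rw [Real.dist_eq, abs_lt] at hs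
    have b1 := hmanti (show t - 1 / ((n : ℝ) + 1) ≤ s by linarith)
    have b2 := hmanti (show s ≤ t + 1 / ((n : ℝ) + 1) by linarith)
    have b3 := hmanti (show t - 1 / ((n : ℝ) + 1) ≤ t by linarith)
    have b4 := hmanti (show t ≤ t + 1 / ((n : ℝ) + 1) by linarith)
    rw [Real.dist_eq, abs_lt]
    constructor <;> linarith
  have hunif := (isCompact_Icc (a := (0 : ℝ)) (b := 1)).uniformContinuousOn_of_continuous
    hcont.continuousOn
  rw [Metric.uniformContinuousOn_iff] at hunif
  obtain ⟨δ, hδ, hδm⟩ := hunif (ε ^ 2) (by positivity)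
  obtain ⟨n, hn⟩ := exists_nat_one_div_lt hδ
  refine ⟨n + 1, n.succ_pos, fun k hk => ?_⟩
  have hn0 : (0 : ℝ) < ((n + 1 : ℕ) : ℝ) := by positivity
  have hk1 : ((k + 1 : ℕ) : ℝ) ≤ ((n + 1 : ℕ) : ℝ) := by exact_mod_cast hk
  have hst : (k : ℝ) / ((n + 1 : ℕ) : ℝ) ≤ ((k + 1 : ℕ) : ℝ) / ((n + 1 : ℕ) : ℝ) := by
    gcongr
    omega
  rw [restrictL2_compl_sub (hU _) (hU _) (hanti hst)]
  apply le_of_sq_le_sq _ hε.le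
  rw [norm_restrictL2_sq, ← hm _ _ hst]
  have hd := hδm ((k : ℝ) / ((n + 1 : ℕ) : ℝ)) ⟨by positivity, hst.trans (by
    rwa [div_le_one hn0])⟩ (((k + 1 : ℕ) : ℝ) / ((n + 1 : ℕ) : ℝ)) ⟨by positivity, by
    rwa [div_le_one hn0]⟩ (by
    rw [Real.dist_eq, abs_sub_comm, ← sub_div, abs_of_nonneg (by
      apply div_nonneg _ hn0.le; push_cast; linarith)]
    push_cast
    rw [add_sub_cancel_left]
    exact hn)
  rw [Real.dist_eq] at hd
  exact (le_abs_self _).trans hd.le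

end Continuity

/-! ### Decomposable vectors -/

section Decomposable

variable {V Y Ω : Type*} [AddCommGroup V] [MeasurableSpace V] [MeasurableSpace Y]
  [AddAction V Y] [MeasurableVAdd V Y] [MeasurableSpace Ω] {lam : Measure Y}
  [VAddInvariantMeasure V Y lam] {X : Set Y} {η : Ω → Measure Y} {prob : Measure Ω}
  [IsProbabilityMeasure prob] {ℓ : ℂ → ℂ} {a b : V} {P : Set V}

omit [MeasurableSpace V] [MeasurableVAdd V Y] [IsProbabilityMeasure prob] in
lemma fiber_eq : fiber η prob X a = lpMeas ℂ ℂ (sigmaOn η prob (X \ (a +ᵥ X))) 2 prob := by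
  have : sigmaAlg η prob X 0 a = sigmaOn η prob (((0 : V) +ᵥ X) \ (a +ᵥ X)) := rfl
  rw [fiber, this, zero_vadd]

omit [MeasurableSpace V] [MeasurableSpace Y] [MeasurableVAdd V Y] in
lemma vadd_subset_vadd (hab : (a - b) +ᵥ X ⊆ X) : a +ᵥ X ⊆ b +ᵥ X := by
  have : a +ᵥ X = b +ᵥ ((a - b) +ᵥ X) := by rw [vadd_vadd, add_sub_cancel]
  rw [this]
  exact Set.vadd_set_mono hab

omit [MeasurableSpace V] [MeasurableSpace Y] [MeasurableVAdd V Y] in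
lemma diff_inter_compl_vadd (hab : (a - b) +ᵥ X ⊆ X) :
    (X \ (a +ᵥ X)) ∩ (b +ᵥ X)ᶜ = X \ (b +ᵥ X) := by
  have h1 := vadd_subset_vadd hab
  ext y
  simp only [Set.mem_inter_iff, Set.mem_sdiff, Set.mem_compl_iff]
  exact ⟨fun h => ⟨h.1.1, h.2⟩, fun h => ⟨⟨h.1, fun h2 => h.2 (h1 h2)⟩, h.2⟩⟩

omit [MeasurableSpace V] [MeasurableSpace Y] [MeasurableVAdd V Y] in
-- The support of S_b E(a - b) as a piece of that of E(a). The double complement is what splitting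
-- along S = (b +ᵥ X)ᶜ produces.
lemma diff_inter_vadd (hb : b +ᵥ X ⊆ X) :
    (X \ (a +ᵥ X)) ∩ (b +ᵥ X)ᶜᶜ = b +ᵥ (X \ ((a - b) +ᵥ X)) := by
  rw [Set.vadd_set_sdiff, vadd_vadd, add_sub_cancel, compl_compl]
  ext y
  simp only [Set.mem_inter_iff, Set.mem_sdiff]
  exact ⟨fun h => ⟨h.2, h.1.2⟩, fun h => ⟨⟨hb h.1, h.2⟩, h.1⟩⟩

/-- Split `f` along X + b. The scalar goes into the first factor, and the second is in the range of
the shift by surjectivity onto functionals of the process on the translated set. -/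
lemma IsPoissonProcess.smul_expVector_isDecomposable [prob.IsComplete]
    (h : IsPoissonProcess η lam prob) (hℓ : IsMeasurableLog ℓ) (hX : MeasurableSet X)
    (hinv : ∀ b ∈ P, b +ᵥ X ⊆ X) {c : ℂ} (hc : c ≠ 0) {f : Lp ℂ 2 lam}
    (hf : f ∈ L2On lam (X \ (a +ᵥ X))) :
    h.IsDecomposable P X a (c • h.expVector hℓ X f) := by
  have hA : MeasurableSet (X \ (a +ᵥ X)) := hX.diff (hX.const_vadd a)
  have hAX : X \ (a +ᵥ X) ⊆ X := Set.sdiff_subset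
  refine ⟨?_, ?_, fun b hb hab => ?_⟩
  · rw [fiber_eq]
    exact Submodule.smul_mem _ _ (h.expVector_mem hℓ hX hA hAX hf)
  · intro h0
    have h1 := h.inner_expVector hℓ hX (L2On_mono hAX hf) (L2On_mono hAX hf)
    rw [(smul_eq_zero.1 h0).resolve_left hc, inner_zero_left] at h1
    exact Complex.exp_ne_zero _ h1.symm
  · have hS := (hX.const_vadd b).compl
    have m1 := h.expVector_mem hℓ hX (hA.inter hS) (inter_subset_left.trans hAX)
      (restrictL2_mem hS hf)
    have m2 := h.expVector_mem hℓ hX (hA.inter hS.compl) (inter_subset_left.trans hAX)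
      (restrictL2_mem hS.compl hf)
    rw [diff_inter_compl_vadd (hinv _ hab)] at m1
    rw [diff_inter_vadd (hinv _ hb)] at m2
    obtain ⟨w, hw, hwx⟩ := h.exists_shift_eq hℓ b m2
    refine ⟨c • h.expVector hℓ X (restrictL2 lam hS f), ?_, w, ?_, ?_⟩
    · rw [fiber_eq]
      exact Submodule.smul_mem _ _ m1
    · rwa [fiber_eq]
    · rw [IsPoissonProcess.mul, hwx]
      apply AEEqFun.ext
      filter_upwards [h.expVector_eq_mul hℓ hX hA hAX hS hf,
        Lp.coeFn_smul c (h.expVector hℓ X f),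
        Lp.coeFn_smul c (h.expVector hℓ X (restrictL2 lam hS f)),
        AEEqFun.coeFn_mul
          ((c • h.expVector hℓ X (restrictL2 lam hS f) : Lp ℂ 2 prob) : Ω →ₘ[prob] ℂ)
          (h.expVector hℓ X (restrictL2 lam hS.compl f) : Ω →ₘ[prob] ℂ)] with ω e1 e2 e3 e4
      rw [e4, Pi.mul_apply, e2, e3, Pi.smul_apply, Pi.smul_apply, e1, smul_mul_assoc]

/-- A decomposable vector has factorizing correlations with the exponential vectors. -/
lemma IsPoissonProcess.IsDecomposable.exists_inner_expVector [prob.IsComplete]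
    {h : IsPoissonProcess η lam prob} (hℓ : IsMeasurableLog ℓ) (hX : MeasurableSet X)
    (hinv : ∀ b ∈ P, b +ᵥ X ⊆ X) {u : Lp ℂ 2 prob} (hu : h.IsDecomposable P X a u)
    (hb : b ∈ P) (hab : a - b ∈ P) :
    ∃ v w : Lp ℂ 2 prob, ∀ f ∈ L2On lam (X \ (a +ᵥ X)), inner ℂ (h.expVector hℓ X f) u =
      inner ℂ (h.expVector hℓ X (restrictL2 lam (hX.const_vadd b).compl f)) v *
        inner ℂ (h.expVector hℓ X (f - restrictL2 lam (hX.const_vadd b).compl f)) w := by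
  have hA : MeasurableSet (X \ (a +ᵥ X)) := hX.diff (hX.const_vadd a)
  have hAX : X \ (a +ᵥ X) ⊆ X := Set.sdiff_subset
  obtain ⟨v, hv, w, hw, huvw⟩ := hu.2.2 b hb hab
  rw [fiber_eq] at hv hw
  have hS := (hX.const_vadd b).compl
  have hw' := h.shift_mem hℓ b hw
  rw [← diff_inter_vadd (hinv _ hb)] at hw'
  rw [← diff_inter_compl_vadd (hinv _ hab)] at hv
  have hz : u =ᵐ[prob] fun ω => v ω * h.shift b w ω := by
    have h1 := AEEqFun.coeFn_mul (v : Ω →ₘ[prob] ℂ) (h.shift b w : Ω →ₘ[prob] ℂ)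
    have h2 : (u : Ω →ₘ[prob] ℂ) = (v : Ω →ₘ[prob] ℂ) * (h.shift b w : Ω →ₘ[prob] ℂ) := huvw
    rw [← h2] at h1
    exact h1
  refine ⟨v, h.shift b w, fun f hf => ?_⟩
  rw [h.inner_expVector_of_mul hℓ hX hA hAX hS hv hw' hz hf]
  congr 3
  rw [eq_sub_iff_add_eq, add_comm]
  exact restrictL2_add_compl hS f

/-- The forward direction tests decomposability along the segment b = t a, 0 ≤ t ≤ 1, where the sets
X + b form a decreasing continuous flow from X to X + a. -/
theorem IsPoissonProcess.isDecomposable_iff [Module ℝ V] [SigmaFinite lam] [prob.IsComplete]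
    (h : IsPoissonProcess η lam prob) (hℓ : IsMeasurableLog ℓ) (hX : MeasurableSet X)
    (hinv : ∀ b ∈ P, b +ᵥ X ⊆ X) (ha : ∀ t : ℝ, 0 ≤ t → t • a ∈ P) (u : Lp ℂ 2 prob) :
    h.IsDecomposable P X a u ↔
      ∃ c : ℂ, c ≠ 0 ∧ ∃ f ∈ L2On lam (X \ (a +ᵥ X)), u = c • h.expVector hℓ X f := by
  constructor
  swap
  · rintro ⟨c, hc, f, hf, rfl⟩
    exact h.smul_expVector_isDecomposable hℓ hX hinv hc hf
  intro hu
  have hA : MeasurableSet (X \ (a +ᵥ X)) := hX.diff (hX.const_vadd a)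
  have hAX : X \ (a +ᵥ X) ⊆ X := Set.sdiff_subset
  have hU : ∀ t : ℝ, MeasurableSet (t • a +ᵥ X)ᶜ := fun t => (hX.const_vadd _).compl
  have hanti : Antitone fun t : ℝ => t • a +ᵥ X := fun s t hst =>
    vadd_subset_vadd (by rw [← sub_smul]; exact hinv _ (ha _ (sub_nonneg.2 hst)))
  have huA := hu.1
  rw [fiber_eq] at huA
  have htotal : ∀ x ∈ lpMeas ℂ ℂ (sigmaOn η prob (X \ (a +ᵥ X))) 2 prob,
      (∀ f ∈ L2On lam (X \ (a +ᵥ X)), inner ℂ (h.expVector hℓ X f) x = 0) → x = 0 := by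
    intro x hx hx0
    refine h.eq_zero_of_inner_expRV hℓ hx fun g hg => ?_
    have h1 := hx0 _ hg.toLp_mem
    have h2 := h.expVector_toLp hℓ hX (hg.mono hAX)
    rw [← h1]
    exact congrArg (fun x' => inner ℂ x' x) h2.symm
  let L := L2On lam (X \ (a +ᵥ X))
  have : CompleteSpace L := (isClosed_L2On hA).completeSpace_coe
  -- Cuts `f` to the part of X ∖ (X + a) not in X + t a: an increasing family of projections from 0
  -- at t = 0 to the identity at t = 1.
  let p : ℝ → L →ₗ[ℂ] L := fun t => (restrictL2 lam (hU t)).toLinearMap.restrict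
    (fun f hf => L2On_mono inter_subset_left (restrictL2_mem (hU t) hf))
  have hp : ∀ t (f : L), ((p t f : L) : Lp ℂ 2 lam) = restrictL2 lam (hU t) f := fun _ _ => rfl
  let E : L → Lp ℂ 2 prob := fun f => h.expVector hℓ X f
  have hE : ∀ g k : L, inner ℂ (E g) (E k) = Complex.exp (inner ℂ g k) := fun g k =>
    h.inner_expVector hℓ hX (L2On_mono hAX g.2) (L2On_mono hAX k.2)
  -- `restrictL2` depends on a measurability proof about its set, so an equality of sets is
  -- transported by substitution.
  have hinter : ∀ {s t : ℝ} (f : Lp ℂ 2 lam) {S : Set Y} (hS : MeasurableSet S),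
      S = (s • a +ᵥ X)ᶜ → restrictL2 lam hS f = restrictL2 lam (hU s) f := by
    rintro s t f S hS rfl
    rfl
  have hpp : ∀ s t, s ≤ t → ∀ g, p s (p t g) = p s g ∧ p t (p s g) = p s g := by
    intro s t hst g
    have hsub : (s • a +ᵥ X)ᶜ ⊆ (t • a +ᵥ X)ᶜ := Set.compl_subset_compl.2 (hanti hst)
    constructor
    · apply Subtype.ext
      rw [hp, hp, hp, restrictL2_restrictL2]
      exact hinter (t := t) _ _ (Set.inter_eq_left.2 hsub)
    · apply Subtype.ext
      rw [hp, hp, restrictL2_restrictL2]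
      exact hinter (t := t) _ _ (Set.inter_eq_right.2 hsub)
  obtain ⟨c, hc, f, hf⟩ := exists_inner_eq_mul_exp (E := E) (u := u) hE
    (h.continuous_expVector_of_subset hℓ hX hAX) p
    (fun t g k => inner_restrictL2 (hU t) (g : Lp ℂ 2 lam) (k : Lp ℂ 2 lam)) hpp
    (fun g => Subtype.ext (restrictL2_eq_zero (hU 0) g.2 (by
      rw [zero_smul, zero_vadd]
      exact disjoint_compl_right.mono_left hAX)))
    (fun g => Subtype.ext (restrictL2_eq_self (hU 1) g.2 (by
      rw [one_smul]
      exact fun y hy => hy.2)))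
    (fun g ε hε => exists_partition_restrictL2_le hX hanti (g : Lp ℂ 2 lam) hε)
    (fun t ht g k => by
      obtain ⟨v, w, hvw⟩ := hu.exists_inner_expVector hℓ hX hinv (ha t ht.1) (by
        have : a - t • a = (1 - t) • a := by module
        rw [this]
        exact ha _ (sub_nonneg.2 ht.2))
      have hΛ : ∀ f : L, inner ℂ (E f) u = inner ℂ (E (p t f)) v * inner ℂ (E (f - p t f)) w :=
        fun f => hvw f f.2
      -- After exchanging the later parts of `g` and `k` the same four scalar factors occur, so the
      -- unknown `v` and `w` disappear from the exchange identity.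
      have hmix : ∀ g k : L, inner ℂ (E (p t g + (k - p t k))) u =
          inner ℂ (E (p t g)) v * inner ℂ (E (k - p t k)) w := by
        intro g k
        have e1 : p t (p t g + (k - p t k)) = p t g := by
          rw [map_add, map_sub, (hpp t t le_rfl g).1, (hpp t t le_rfl k).1, sub_self, add_zero]
        rw [hΛ, e1, add_sub_cancel_left]
      rw [hmix, hmix, hΛ g, hΛ k]
      ring)
    (by
      by_contra! h0
      exact hu.2.1 (htotal u huA fun f hf => h0 ⟨f, hf⟩))
  refine ⟨c, hc, f, f.2, ?_⟩
  -- u - c • Σ_f has zero inner product with all exponential vectors on X ∖ (X + a), so totality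
  -- applies.
  rw [← sub_eq_zero]
  refine htotal _ (Submodule.sub_mem _ huA (Submodule.smul_mem _ _
    (h.expVector_mem hℓ hX hA hAX f.2))) fun g hg => ?_
  have e1 := hf ⟨g, hg⟩
  have e2 := hE ⟨g, hg⟩ f
  rw [← e2] at e1
  rw [inner_sub_right, inner_smul_right, sub_eq_zero]
  exact e1

end Decomposable

end PoissonProductSystem

theorem corollary4p2 {d : ℕ} (P : ConvexCone ℝ (EuclideanSpace ℝ (Fin d)))
    (hP_closed : IsClosed (P : Set (EuclideanSpace ℝ (Fin d))))
    (hP_spanning : (P : Set (EuclideanSpace ℝ (Fin d))) - (P : Set (EuclideanSpace ℝ (Fin d))) =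
      Set.univ)
    (hP_pointed : (P : Set (EuclideanSpace ℝ (Fin d))) ∩ -(P : Set (EuclideanSpace ℝ (Fin d))) =
      {0})
    {Y : Type*} [MeasurableSpace Y] [MeasurableSpace.CountablyGenerated Y]
    [AddAction (EuclideanSpace ℝ (Fin d)) Y] [MeasurableVAdd₂ (EuclideanSpace ℝ (Fin d)) Y]
    (lam : Measure Y) [SigmaFinite lam]
    [VAddInvariantMeasure (EuclideanSpace ℝ (Fin d)) Y lam]
    {X : Set Y} (hX : MeasurableSet X) (hX_invariant : ∀ a ∈ P, a +ᵥ X ⊆ X)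
    (hX_pure : (⋂ a ∈ P, a +ᵥ X) = (∅ : Set Y))
    {Ω : Type*} [MeasurableSpace Ω] (prob : Measure Ω) [IsProbabilityMeasure prob]
    [prob.IsComplete] (η : Ω → Measure Y)
    (hη : PoissonProductSystem.IsPoissonProcess η lam prob)
    (ℓ : ℂ → ℂ) (hℓ : PoissonProductSystem.IsMeasurableLog ℓ)
    (a : EuclideanSpace ℝ (Fin d)) (ha : a ∈ P) :
    {u : Lp ℂ 2 prob | hη.IsDecomposable (P : Set (EuclideanSpace ℝ (Fin d))) X a u} =
      {u : Lp ℂ 2 prob | ∃ c : ℂ, c ≠ 0 ∧ ∃ f ∈ PoissonProductSystem.L2On lam (X \ (a +ᵥ X)),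
        u = c • hη.expVector hℓ X f} := by
  -- A `ConvexCone` is closed under positive scalars only; the endpoint t = 0 of the segment needs 0
  -- ∈ P, which pointedness supplies.
  have h0 : (0 : EuclideanSpace ℝ (Fin d)) ∈ P := by
    have : (0 : EuclideanSpace ℝ (Fin d)) ∈
        (P : Set (EuclideanSpace ℝ (Fin d))) ∩ -(P : Set (EuclideanSpace ℝ (Fin d))) := by
      rw [hP_pointed]
      exact Set.mem_singleton 0
    exact this.1
  ext u
  refine hη.isDecomposable_iff hℓ hX hX_invariant (fun t ht => ?_) u
  rcases ht.eq_or_lt with rfl | ht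
  · rw [zero_smul]
    exact h0
  · exact P.smul_mem ht ha
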